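/- **Setting.** Let $M$ be an episodic tabular MDP: finite non-empty state and action sets $\mathcal S,\mathcal A$ of sizes $S$ and $A$, horizon $H\ge 1$, transition kernels $P_h(\cdot\mid s,a)$, deterministic rewards $R_h(s,a)\in[0,1]$, and a fixed initial state $x_1$. Policies $\pi=(\pi_h)_{h\in[H]}$, $\pi_h:\mathcal S\to\Delta(\mathcal A)$, may be randomized and step-dependent; $d^\pi_h(s,a)$ is the probability that $(s_h,a_h)=(s,a)$ under $\pi$, $V_1^\pi(x_1)$ is the expected total reward of $\pi$, and $V^\star_1(x_1)=\sup_\pi V^\pi_1(x_1)$. The offline data $\mathcal D_{\rm off}$ are $N_{\rm off}\ge1$ independent episodes of a fixed policy $\pi_{\rm off}$, with $\mu_h=d_h^{\pi_{\rm off}}$; then $N_{\rm on}\ge1$ online episodes are run, and $N=N_{\rm off}+N_{\rm on}$. Let $\mathcal F_h=[0,H]^{\mathcal S\times\mathcal A}$ for every $h\in[H]$, $\mathcal F=\prod_h\mathcal F_h$, $f_{H+1}=0$, $\mathcal T_hf_{h+1}(s,a)=R_h(s,a)+\mathbb E_{s'\sim P_h(\cdot|s,a)}[\max_{a'}f_{h+1}(s',a')]$,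 and $\delta^f_h=f_h-\mathcal T_hf_{h+1}$. For $\mathcal X'\subseteq\mathcal X=\mathcal S\times\mathcal A\times[H]$ write $\mathcal X'_h=\{(s,a):(s,a,h)\in\mathcal X'\}$ and put $$c_{\rm off}(\mathcal F,\mathcal X')=\max_h\sup_{f\in\mathcal F}\sup_\pi\frac{\mathbb E_{d^\pi_h}[(\delta_h^f)^2\mathbb 1_{\mathcal X'_h}]}{\mathbb E_{\mu_h}[(\delta_h^f)^2\mathbb 1_{\mathcal X'_h}]},\qquad c_{\rm on}(\mathcal F,\mathcal X',T)=\max_h\sup_{f^{(1)},\dots,f^{(T)}\in\mathcal F}\ \sup_{\pi^{(1)},\dots,\pi^{(T)}}\sum_{t=1}^T\frac{\big(\mathbb E_{d_h^{\pi^{(t)}}}[\delta_h^{f^{(t)}}\mathbb 1_{\mathcal X'_h}]\big)^2}{H^2\vee\sum_{i<t}\mathbb E_{d_h^{\pi^{(i)}}}[(\delta_h^{f^{(t)}})^2\mathbb 1_{\mathcal X'_h}]},$$ with the conventions $0/0=0$ and $x/0=\infty$ for $x>0$. **Algorithm (DISC-GOLF).** For $f\in\mathcal F$ let $\pi_f$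 be a greedy policy of $f$ (ties broken arbitrarily). For a width $w>0$ let $\mathcal F^{(t)}$ be the set of all $f\in\mathcal F$ such that $\mathcal L^{(t)}_h(f_h,f_{h+1})-\min_{g\in\mathcal F_h}\mathcal L^{(t)}_h(g,f_{h+1})\le w$ for all $h\in[H]$, where $\mathcal L^{(t)}_h(g,g')=\sum(g(s_h,a_h)-r_h-\max_{a'}g'(s_{h+1},a'))^2$, the sum being over all episodes of $\mathcal D_{\rm off}$ and the first $t$ online episodes. In online episode $t+1$ the algorithm runs $\pi^{(t+1)}=\pi_{f^{(t+1)}}$, where $f^{(t+1)}$ is any maximizer of $f\mapsto f_1(x_1,\pi_{f,1}(x_1))$ over $\mathcal F^{(t)}$ (warm start). In the cold-start variant the first function $f^{(1)}$ is instead a maximizer over the whole class $\mathcal F$. The regret is $\mathrm{Reg}(N_{\rm on})=\sum_{t=1}^{N_{\rm on}}\big(V_1^\star(x_1)-V_1^{\pi^{(t)}}(x_1)\big)$. Let $\mathcal N_{\mathcal F}(\rho)$ be the $\rho$-covering number of $\mathcal F$ in the sup norm. **Proposition.** There are absolute constants $c_1,C>0$ such that, for all of the above: 1. For every $\mathcal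 X_{\rm off}\subseteq\mathcal X$, $$c_{\rm off}(\mathcal F,\mathcal X_{\rm off})\le\sup_\pi\sup_{(s,a,h)\in\mathcal X_{\rm off}}\frac{d_h^\pi(s,a)}{\mu_h(s,a)}=\sup_\pi\Big\|\frac{d^\pi\mathbb 1_{\mathcal X_{\rm off}}}{\mu}\Big\|_\infty .$$ 2. If $N_{\rm on}\ge2$, then for every $\mathcal X_{\rm on}\subseteq\mathcal X$, $\ c_{\rm on}(\mathcal F,\mathcal X_{\rm on},N_{\rm on})\le C\max_{h}|\mathcal X_{{\rm on},h}|\log N_{\rm on}$. 3. For every $\delta\in(0,1)$, DISC-GOLF with width $w=H^2\beta$, $\beta=c_1\log\big(NH\,\mathcal N_{\mathcal F}(1/N)/\delta\big)$, satisfies with probability at least $1-\delta$ $$\mathrm{Reg}(N_{\rm on})\le C\inf_{\mathcal X_{\rm off}\cup\mathcal X_{\rm on}=\mathcal X}\left(\sqrt{H^5SA\log\tfrac N\delta\,\frac{N_{\rm on}^2}{N_{\rm off}}\sup_\pi\Big\|\frac{d^\pi\mathbb 1_{\mathcal X_{\rm off}}}{\mu}\Big\|_\infty}+\sqrt{H^5SA\max_h|\mathcal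 X_{{\rm on},h}|\,N_{\rm on}\log\tfrac N\delta\,\log N}\right),$$ where $\mathcal X_{\rm off},\mathcal X_{\rm on}$ need not be disjoint; in the cold-start variant the infimum is over the pairs with $\mathcal X_{\rm on}\ne\emptyset$. -/

import Mathlib

open scoped BigOperators ENNReal NNReal

noncomputable section

namespace HybridRL

/-- An episodic Markov decision process with state space `S`, action space `A`, horizon `H`
(steps are numbered `0, …, H - 1`), transition kernels `P h s a ∈ Δ(S)`, deterministic rewards
`R h s a ∈ [0, 1]`, and the fixed initial state `x₁` of every episode. -/
structure MDP (S A : Type*) [Fintype S] (H : ℕ) where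
  P : Fin H → S → A → stdSimplex ℝ S
  R : Fin H → S → A → ℝ
  R_mem : ∀ h s a, R h s a ∈ Set.Icc (0 : ℝ) 1
  x₁ : S

/-- A (randomized, step-dependent) policy: `π h s ∈ Δ(A)`. -/
abbrev Policy (S A : Type*) [Fintype A] (H : ℕ) : Type _ := Fin H → S → stdSimplex ℝ A

/-- A family `f = (f_h)_{h < H}` of functions on `S × A`. -/
abbrev QFun (S A : Type*) (H : ℕ) : Type _ := Fin H → S → A → ℝ

/-- A trajectory of one episode: the states `s_0, …, s_H` and the actions `a_0, …, a_{H-1}`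
(the rewards are functions of these). -/
abbrev Traj (S A : Type*) (H : ℕ) : Type _ := (Fin (H + 1) → S) × (Fin H → A)

variable {S A : Type*} [Fintype S] [Fintype A] {H : ℕ}

/-! ### Trajectory law, values, occupancy measures -/

open Classical in
/-- The probability of the trajectory `τ` when the policy `π` is run for one episode. -/
def trajProb (M : MDP S A H) (π : Policy S A H) (τ : Traj S A H) : ℝ :=
  (if τ.1 0 = M.x₁ then 1 else 0) *
    ∏ h : Fin H, π h (τ.1 h.castSucc) (τ.2 h) *
      M.P h (τ.1 h.castSucc) (τ.2 h) (τ.1 h.succ)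

/-- The expected total reward `V^π_1(x₁)` of one episode under `π`. -/
def value (M : MDP S A H) (π : Policy S A H) : ℝ :=
  ∑ τ : Traj S A H, trajProb M π τ * ∑ h : Fin H, M.R h (τ.1 h.castSucc) (τ.2 h)

/-- The optimal value `V^⋆_1(x₁)`. -/
def optValue (M : MDP S A H) : ℝ := ⨆ π : Policy S A H, value M π

open Classical in
/-- The occupancy measure `d^π_h(s, a)`: the probability that `(s_h, a_h) = (s, a)` under `π`. -/
def occ (M : MDP S A H) (π : Policy S A H) (h : Fin H) (s : S) (a : A) : ℝ :=
  ∑ τ : Traj S A H, if τ.1 h.castSucc = s ∧ τ.2 h = a then trajProb M π τ else 0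

/-- `E_{(s,a) ∼ d}[g(s,a)]` for a density `d` on `S × A`. -/
def expect (d g : S → A → ℝ) : ℝ := ∑ s, ∑ a, d s a * g s a

/-! ### The tabular function class and the Bellman error -/

/-- The tabular class at one step: all functions `S × A → [0, H]`. -/
def stepClass (S A : Type*) (H : ℕ) : Set (S → A → ℝ) :=
  {g | ∀ s a, g s a ∈ Set.Icc (0 : ℝ) H}

/-- The tabular class `F`, with `F_h = [0, H]^{S × A}` for every `h`. -/
def qClass (S A : Type*) (H : ℕ) : Set (QFun S A H) :=
  {f | ∀ h, f h ∈ stepClass S A H}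

/-- `f_{h+1}`, which is the zero function after the last step. -/
def nextQ (f : QFun S A H) (h : Fin H) : S → A → ℝ :=
  if hh : (h : ℕ) + 1 < H then f ⟨(h : ℕ) + 1, hh⟩ else fun _ _ => 0

/-- The Bellman operator
`(T_h g)(s, a) = R_h(s, a) + E_{s' ∼ P_h(· | s, a)} max_{a'} g(s', a')`. -/
def bellman (M : MDP S A H) (h : Fin H) (g : S → A → ℝ) (s : S) (a : A) : ℝ :=
  M.R h s a + ∑ s', M.P h s a s' * ⨆ a', g s' a'

/-- The Bellman error `f_h - T_h f_{h+1}`. -/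
def bellmanErr (M : MDP S A H) (f : QFun S A H) (h : Fin H) (s : S) (a : A) : ℝ :=
  f h s a - bellman M h (nextQ f h) s a

/-- The Bellman error `(f_h - T_h f_{h+1}) 1_{(·, h) ∈ X}` restricted to `X ⊆ S × A × [H]`. -/
def restrErr (M : MDP S A H) (X : Set (S × A × Fin H)) (f : QFun S A H) (h : Fin H)
    (s : S) (a : A) : ℝ :=
  X.indicator (fun x => bellmanErr M f x.2.2 x.1 x.2.1) (s, a, h)

/-! ### Complexity measures

They take values in `[0, ∞]`, with `0 / 0 = 0` and `x / 0 = ∞` for `x > 0`. -/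

/-- The partial all-policy concentrability coefficient `c_off(F, X)`, where `μ = d^{πoff}`. -/
def cOff (M : MDP S A H) (πoff : Policy S A H) (X : Set (S × A × Fin H)) : ℝ≥0∞ :=
  ⨆ (h : Fin H) (f ∈ qClass S A H) (π : Policy S A H),
    ENNReal.ofReal (expect (occ M π h) fun s a => restrErr M X f h s a ^ 2) /
      ENNReal.ofReal (expect (occ M πoff h) fun s a => restrErr M X f h s a ^ 2)

/-- The partial sequential extrapolation coefficient `c_on(F, X, T)`. -/
def cOn (M : MDP S A H) (X : Set (S × A × Fin H)) (T : ℕ) : ℝ≥0∞ :=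
  ⨆ (h : Fin H) (f : Fin T → QFun S A H) (_ : ∀ t, f t ∈ qClass S A H)
    (π : Fin T → Policy S A H),
    ENNReal.ofReal (∑ t : Fin T,
      expect (occ M (π t) h) (restrErr M X (f t) h) ^ 2 /
        max ((H : ℝ) ^ 2)
          (∑ i ∈ Finset.Iio t, expect (occ M (π i) h) fun s a => restrErr M X (f t) h s a ^ 2))

/-- `sup_π sup_{(s,a,h) ∈ X} d^π_h(s,a) / μ_h(s,a)`, where `μ = d^{πoff}`. -/
def ratioSup (M : MDP S A H) (πoff : Policy S A H) (X : Set (S × A × Fin H)) : ℝ≥0∞ :=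
  ⨆ (π : Policy S A H) (x ∈ X),
    ENNReal.ofReal (occ M π x.2.2 x.1 x.2.1) / ENNReal.ofReal (occ M πoff x.2.2 x.1 x.2.1)

/-- `sup_π ‖d^π 1_X / μ‖_∞`, the sup norm being over all of `S × A × [H]`. -/
def ratioNorm (M : MDP S A H) (πoff : Policy S A H) (X : Set (S × A × Fin H)) : ℝ≥0∞ :=
  ⨆ (π : Policy S A H) (x : S × A × Fin H),
    ENNReal.ofReal (X.indicator (fun y => occ M π y.2.2 y.1 y.2.1) x) /
      ENNReal.ofReal (occ M πoff x.2.2 x.1 x.2.1)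

/-- `max_h |X_h|`, where `X_h = {(s, a) : (s, a, h) ∈ X}`. -/
def maxSlice (X : Set (S × A × Fin H)) : ℕ :=
  Finset.univ.sup fun h : Fin H => {p : S × A | (p.1, p.2, h) ∈ X}.ncard

/-! ### Learning from offline data and online interaction -/

/-- A learning algorithm: it maps the offline dataset and the `t` online trajectories observed so
far to the policy of the next online episode. -/
abbrev Learner (S A : Type*) [Fintype A] (H Noff : ℕ) : Type _ :=
  (t : ℕ) → (Fin Noff → Traj S A H) → (Fin t → Traj S A H) → Policy S A H

/-- The policy that `L` runs in online episode `t` (numbered from `0`), when the offline dataset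
and the online trajectories are those of `ω`. -/
def playedPolicy {Noff Non : ℕ} (L : Learner S A H Noff)
    (ω : (Fin Noff → Traj S A H) × (Fin Non → Traj S A H)) (t : Fin Non) : Policy S A H :=
  L t ω.1 fun i : Fin (t : ℕ) => ω.2 (Fin.castLE t.isLt.le i)

/-- The joint probability of the offline dataset (`Noff` independent episodes of `πoff`) and of the
`Non` online trajectories generated by `L` in interaction with the MDP. -/
def runProb {Noff Non : ℕ} (M : MDP S A H) (πoff : Policy S A H) (L : Learner S A H Noff)
    (ω : (Fin Noff → Traj S A H) × (Fin Non → Traj S A H)) : ℝ :=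
  (∏ i, trajProb M πoff (ω.1 i)) * ∏ t, trajProb M (playedPolicy L ω t) (ω.2 t)

/-- The probability of an event about the offline dataset and the online trajectories. -/
def probEvent {Noff Non : ℕ} (M : MDP S A H) (πoff : Policy S A H) (L : Learner S A H Noff)
    (E : Set ((Fin Noff → Traj S A H) × (Fin Non → Traj S A H))) : ℝ :=
  ∑ ω, E.indicator (runProb M πoff L) ω

/-- The regret `∑_t (V^⋆_1(x₁) - V^{π^{(t)}}_1(x₁))` of the policies that were played. -/
def regret {Noff Non : ℕ} (M : MDP S A H) (L : Learner S A H Noff)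
    (ω : (Fin Noff → Traj S A H) × (Fin Non → Traj S A H)) : ℝ :=
  ∑ t, (optValue M - value M (playedPolicy L ω t))

/-! ### The algorithm DISC-GOLF -/

/-- The squared loss of `g` at step `h` on one trajectory, with regression target
`r_h + max_{a'} g'(s_{h+1}, a')`. -/
def stepLoss (M : MDP S A H) (h : Fin H) (g g' : S → A → ℝ) (τ : Traj S A H) : ℝ :=
  (g (τ.1 h.castSucc) (τ.2 h) - M.R h (τ.1 h.castSucc) (τ.2 h) - ⨆ a', g' (τ.1 h.succ) a') ^ 2

/-- The loss `L_h^{(t)}(g, g')` over the offline dataset and `t` online trajectories. -/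
def loss {Noff t : ℕ} (M : MDP S A H) (off : Fin Noff → Traj S A H) (on : Fin t → Traj S A H)
    (h : Fin H) (g g' : S → A → ℝ) : ℝ :=
  ∑ i, stepLoss M h g g' (off i) + ∑ i, stepLoss M h g g' (on i)

/-- The confidence set of width `w`: all `f ∈ F` with
`L_h(f_h, f_{h+1}) - min_{g ∈ F_h} L_h(g, f_{h+1}) ≤ w` for all `h`. -/
def confSet {Noff t : ℕ} (M : MDP S A H) (w : ℝ) (off : Fin Noff → Traj S A H)
    (on : Fin t → Traj S A H) : Set (QFun S A H) :=
  {f | f ∈ qClass S A H ∧ ∀ h, ∀ g ∈ stepClass S A H,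
    loss M off on h (f h) (nextQ f h) - loss M off on h g (nextQ f h) ≤ w}

/-- The set from which the function of the next online episode is chosen after `t` online episodes.
For `t ≥ 1` it is the confidence set of all data. For `t = 0` it is the whole class `F`
(`warm = false`), or the confidence set of the offline data alone (`warm = true`). -/
def candSet {Noff : ℕ} (M : MDP S A H) (w : ℝ) (warm : Bool) (t : ℕ)
    (off : Fin Noff → Traj S A H) (on : Fin t → Traj S A H) : Set (QFun S A H) :=
  if t = 0 ∧ warm = false then qClass S A H else confSet M w off on

/-- `gr f` is a greedy policy of `f`, for every `f`; ties are broken in any way. -/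
def IsGreedy (gr : QFun S A H → Fin H → S → A) : Prop :=
  ∀ (f : QFun S A H) (h : Fin H) (s : S) (a : A), f h s a ≤ f h s (gr f h s)

open Classical in
/-- The deterministic policy that takes action `p h s`. -/
def detPolicy (p : Fin H → S → A) : Policy S A H :=
  fun h s => ⟨Pi.single (p h s) 1, single_mem_stdSimplex ℝ (p h s)⟩

/-- `sel` makes the optimistic choices of DISC-GOLF with confidence width `w`: it selects, in each
candidate set, a maximizer of `f ↦ f_1(x₁, π_{f,1}(x₁))`, `π_f = gr f`. -/
def IsDiscGolf [NeZero H] {Noff : ℕ} (M : MDP S A H) (w : ℝ) (warm : Bool)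
    (gr : QFun S A H → Fin H → S → A)
    (sel : (t : ℕ) → (Fin Noff → Traj S A H) → (Fin t → Traj S A H) → QFun S A H) : Prop :=
  ∀ t off on, sel t off on ∈ candSet M w warm t off on ∧
    ∀ f ∈ candSet M w warm t off on,
      f 0 M.x₁ (gr f 0 M.x₁) ≤ sel t off on 0 M.x₁ (gr (sel t off on) 0 M.x₁)

/-- The learner that plays the greedy policies of the selected functions. -/
def golfLearner {Noff : ℕ} (gr : QFun S A H → Fin H → S → A)
    (sel : (t : ℕ) → (Fin Noff → Traj S A H) → (Fin t → Traj S A H) → QFun S A H) :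
    Learner S A H Noff :=
  fun t off on => detPolicy (gr (sel t off on))

/-- `log(N H 𝒩_F(1/N) / δ)`, where `𝒩_F(ρ)` is the `ρ`-covering number of `F` in the sup norm. -/
def logCover (S A : Type*) [Fintype S] [Fintype A] (H N : ℕ) (δ : ℝ) : ℝ :=
  Real.log (N * H * (Metric.coveringNumber (1 / (N : ℝ≥0)) (qClass S A H)).toNat / δ)

/-- `√(H⁵ S A log(N/δ) (Non²/Noff) r) + √(H⁵ S A m Non log(N/δ) log N)` with
`r = sup_π ‖d^π 1_{Xoff} / μ‖_∞`, `m = max_h |Xon_h|` and `N = Noff + Non`. -/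
def regretBound (M : MDP S A H) (πoff : Policy S A H) (Noff Non : ℕ) (δ : ℝ)
    (Xoff Xon : Set (S × A × Fin H)) : ℝ≥0∞ :=
  (ENNReal.ofReal ((H : ℝ) ^ 5 * Fintype.card S * Fintype.card A *
      Real.log (((Noff + Non : ℕ) : ℝ) / δ) * ((Non : ℝ) ^ 2 / Noff)) *
    ratioNorm M πoff Xoff) ^ (1 / 2 : ℝ) +
  ENNReal.ofReal (Real.sqrt ((H : ℝ) ^ 5 * Fintype.card S * Fintype.card A * maxSlice Xon * Non *
      Real.log (((Noff + Non : ℕ) : ℝ) / δ) * Real.log ((Noff + Non : ℕ) : ℝ)))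

end HybridRL

end

open HybridRL

noncomputable section

set_option linter.unusedSectionVars false

/-! The two coefficient bounds are pointwise facts about tables. If the ratio of `d^π` to `μ` is at
most `r` on `X`, then `d^π ≤ r μ` there, and this can be integrated against any squared error. For
the online coefficient, each cell `(s, a)` has its own one-dimensional potential `∑_t d_t / max(1,
∑_{i<t} d_i) ≤ 3 log(1 + T)`. Cauchy–Schwarz over the cells reduces the coefficient to the sum of
these potentials (`sum_sq_div_max_le`).

The regret bound is optimism plus least squares. The tabular class is not closed under the Bellman
operator, whose values reach `H + 1`, so regression is compared with the backup clipped at `H`.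
Clipping is a projection onto an interval that contains the values of the class. Hence the excess
loss over the clipped backup has conditional mean at least the squared clipped error
(`expect_clipErr_sq_le_trajExp_excess`). Its variance is controlled by the same squared error, which
gives an exponential supermartingale (`trajExp_exp_le_one`). Markov's inequality and a union bound
over a `1/N`-cover then yield an event of probability at least `1 - δ`
(`one_sub_le_probEvent_accurateEvent`). On it the optimal action values belong to every confidence
set, and every member of a confidence set has squared clipped error `O(H² β)` on the distributions
that generated the data.

By optimism and telescoping, an episode's regret is at most the sum over `h` of the expected Bellman
errors of the selected function, and clipping only increases these errors. Each expectation is split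
over `Xoff` and `Xon`. The first part is transferred to `μ` by the density ratio, and the second is
summed over episodes by the potential bound (`sum_expect_abs_le`). It remains to bound the log
covering number by `5 H S A log(N/δ)`, which needs `H ≤ N`; when `N < H` the trivial bound `Non * H`
on the regret is already small enough. -/

namespace HybridRL

/-! ### Sums over trajectories -/

section Paths

variable {S A : Type*} [Fintype S] [Fintype A]

/-- The total weight of all trajectories, for an initial weight `ν` and transition weights `w`. -/
def pathSum {n : ℕ} (ν : S → ℝ) (w : Fin n → S → A → S → ℝ) : ℝ :=
  ∑ τ : Traj S A n, ν (τ.1 0) * ∏ h, w h (τ.1 h.castSucc) (τ.2 h) (τ.1 h.succ)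

lemma pathSum_zero (ν : S → ℝ) (w : Fin 0 → S → A → S → ℝ) : pathSum ν w = ∑ s, ν s := by
  unfold pathSum
  rw [Fintype.sum_prod_type]
  simp only [Finset.univ_eq_empty, Finset.prod_empty, mul_one, Finset.sum_const,
    Finset.card_univ, Fintype.card_unique, one_smul]
  exact Fintype.sum_equiv (Equiv.funUnique (Fin 1) S) _ _ fun _ => rfl

/-- Summing out the first state and action absorbs the first transition into the initial weight.
This makes induction on the horizon work, provided the initial weight is kept arbitrary. -/
lemma pathSum_succ {n : ℕ} (ν : S → ℝ) (w : Fin (n + 1) → S → A → S → ℝ) :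
    pathSum ν w = pathSum (fun s' => ∑ s, ∑ a, ν s * w 0 s a s') (fun h => w h.succ) := by
  unfold pathSum
  rw [← Equiv.sum_comp ((Fin.consEquiv fun _ => S).prodCongr (Fin.consEquiv fun _ => A))]
  simp only [Fintype.sum_prod_type, Equiv.prodCongr_apply, Prod.map, Fin.consEquiv_apply,
    Fin.prod_univ_succ, Fin.cons_zero, Fin.castSucc_zero, Fin.cons_succ, ← Fin.succ_castSucc]
  rw [Finset.sum_comm]
  refine Finset.sum_congr rfl fun σ _ => ?_
  simp only [Finset.sum_mul]
  conv_rhs => rw [Finset.sum_comm]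
  refine Finset.sum_congr rfl fun s _ => ?_
  conv_rhs => rw [Finset.sum_comm]
  exact Finset.sum_congr rfl fun a _ => Finset.sum_congr rfl fun α _ => by ring

lemma pathSum_eq_of_stochastic {n : ℕ} (ν : S → ℝ) (w : Fin n → S → A → S → ℝ)
    (hw : ∀ h s, ∑ a, ∑ s', w h s a s' = 1) : pathSum ν w = ∑ s, ν s := by
  induction n generalizing ν with
  | zero => exact pathSum_zero ν w
  | succ n ih =>
    rw [pathSum_succ, ih _ _ fun h => hw h.succ, Finset.sum_comm]
    refine Finset.sum_congr rfl fun s _ => ?_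
    rw [Finset.sum_comm]
    simp only [← Finset.mul_sum, hw, mul_one]

/-- The steps after `h₀` sum out to 1, and then step `h₀` contributes 0 from every state, whatever
the weights before it. It is applied to a transition weight multiplied by a function that is centred
at step `h₀`. -/
lemma pathSum_eq_zero {n : ℕ} (ν : S → ℝ) (w : Fin n → S → A → S → ℝ) (h₀ : Fin n)
    (h0 : ∀ s, ∑ a, ∑ s', w h₀ s a s' = 0)
    (hw : ∀ h, h₀ < h → ∀ s, ∑ a, ∑ s', w h s a s' = 1) : pathSum ν w = 0 := by
  induction n generalizing ν with
  | zero => exact h₀.elim0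
  | succ n ih =>
    rw [pathSum_succ]
    refine Fin.cases (fun h0 hw => ?_) (fun h₁ h0 hw => ?_) h₀ h0 hw
    · rw [pathSum_eq_of_stochastic _ _ fun h => hw h.succ h.succ_pos, Finset.sum_comm]
      refine Finset.sum_eq_zero fun s _ => ?_
      rw [Finset.sum_comm]
      simp only [← Finset.mul_sum, h0, mul_zero]
    · exact ih _ _ h₁ h0 fun h hh => hw h.succ (Fin.succ_lt_succ_iff.2 hh)

variable {H : ℕ} (M : MDP S A H) (π : Policy S A H)

lemma policy_nonneg (h : Fin H) (s : S) (a : A) : 0 ≤ π h s a := (π h s).2.1 a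

lemma policy_sum (h : Fin H) (s : S) : ∑ a, π h s a = 1 := (π h s).2.2

lemma kernel_nonneg (h : Fin H) (s : S) (a : A) (s' : S) : 0 ≤ M.P h s a s' := (M.P h s a).2.1 s'

lemma kernel_sum (h : Fin H) (s : S) (a : A) : ∑ s', M.P h s a s' = 1 := (M.P h s a).2.2

lemma trajProb_nonneg (τ : Traj S A H) : 0 ≤ trajProb M π τ := by
  unfold trajProb
  refine mul_nonneg (by split_ifs <;> norm_num) (Finset.prod_nonneg fun h _ => ?_)
  exact mul_nonneg (policy_nonneg π _ _ _) (kernel_nonneg M _ _ _ _)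

lemma step_sum (h : Fin H) (s : S) : ∑ a, ∑ s', π h s a * M.P h s a s' = 1 := by
  simp only [← Finset.mul_sum, kernel_sum, mul_one, policy_sum]

lemma sum_trajProb : ∑ τ : Traj S A H, trajProb M π τ = 1 := by
  classical
  have := pathSum_eq_of_stochastic (fun s => if s = M.x₁ then (1 : ℝ) else 0)
    (fun h s a s' => π h s a * M.P h s a s') (step_sum M π)
  rw [Finset.sum_ite_eq' Finset.univ M.x₁, if_pos (Finset.mem_univ _)] at this
  rw [← this]
  unfold pathSum trajProb
  refine Finset.sum_congr rfl fun τ _ => ?_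
  congr 1

/-- The expectation of a function of the trajectory of one episode. -/
def trajExp (φ : Traj S A H → ℝ) : ℝ := ∑ τ, trajProb M π τ * φ τ

lemma trajExp_const (c : ℝ) : trajExp M π (fun _ => c) = c := by
  unfold trajExp
  rw [← Finset.sum_mul, sum_trajProb, one_mul]

lemma trajExp_mono {φ ψ : Traj S A H → ℝ} (h : ∀ τ, trajProb M π τ ≠ 0 → φ τ ≤ ψ τ) :
    trajExp M π φ ≤ trajExp M π ψ := by
  refine Finset.sum_le_sum fun τ _ => ?_
  by_cases h0 : trajProb M π τ = 0
  · simp [h0]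
  · exact mul_le_mul_of_nonneg_left (h τ h0) (trajProb_nonneg M π τ)

lemma trajExp_sub (φ ψ : Traj S A H → ℝ) :
    trajExp M π (fun τ => φ τ - ψ τ) = trajExp M π φ - trajExp M π ψ := by
  simp only [trajExp, mul_sub, Finset.sum_sub_distrib]

lemma trajExp_sum {ι : Type*} (s : Finset ι) (φ : ι → Traj S A H → ℝ) :
    trajExp M π (fun τ => ∑ i ∈ s, φ i τ) = ∑ i ∈ s, trajExp M π (φ i) := by
  simp only [trajExp, Finset.mul_sum]
  exact Finset.sum_comm

lemma value_eq_trajExp :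
    value M π = trajExp M π fun τ => ∑ h : Fin H, M.R h (τ.1 h.castSucc) (τ.2 h) := rfl

lemma trajExp_stateAction (h : Fin H) (φ : S → A → ℝ) :
    trajExp M π (fun τ => φ (τ.1 h.castSucc) (τ.2 h)) = expect (occ M π h) φ := by
  classical
  unfold trajExp expect occ
  simp only [Finset.sum_mul]
  conv_rhs =>
    enter [2, s]
    rw [Finset.sum_comm]
  rw [Finset.sum_comm]
  refine Finset.sum_congr rfl fun τ _ => ?_
  rw [Finset.sum_eq_single (τ.1 h.castSucc), Finset.sum_eq_single (τ.2 h)]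
  · simp
  · intro a _ ha
    rw [if_neg (fun h => ha h.2.symm), zero_mul]
  · simp
  · intro s _ hs
    refine Finset.sum_eq_zero fun a _ => ?_
    rw [if_neg (fun h => hs h.1.symm), zero_mul]
  · simp

/-- The next state is drawn from the transition kernel, given the current state and action. -/
lemma trajExp_transition (h : Fin H) (φ : S → A → S → ℝ) :
    trajExp M π (fun τ => φ (τ.1 h.castSucc) (τ.2 h) (τ.1 h.succ)) =
      expect (occ M π h) fun s a => ∑ s', M.P h s a s' * φ s a s' := by
  classical
  rw [← trajExp_stateAction, ← sub_eq_zero, ← trajExp_sub]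
  -- `ψ` is `φ` minus its conditional mean, so inserting it at step `h` alone makes the trajectory
  -- sum vanish.
  set ψ : S → A → S → ℝ := fun s a s' => φ s a s' - ∑ s'', M.P h s a s'' * φ s a s'' with hψ
  have key := pathSum_eq_zero (fun s => if s = M.x₁ then (1 : ℝ) else 0)
    (fun k s a s' => π k s a * M.P k s a s' * if k = h then ψ s a s' else 1) h
    (fun s => by
      refine Finset.sum_eq_zero fun a _ => ?_
      simp only [if_true, mul_assoc, ← Finset.mul_sum]
      have : ∑ s', M.P h s a s' * ψ s a s' = 0 := by
        simp only [hψ, mul_sub, Finset.sum_sub_distrib, ← Finset.sum_mul, kernel_sum, one_mul,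
          sub_self]
      rw [this, mul_zero])
    (fun k hk s => by
      simp only [if_neg hk.ne', mul_one]
      exact step_sum M π k s)
  rw [← key]
  unfold trajExp pathSum trajProb
  refine Finset.sum_congr rfl fun τ _ => ?_
  rw [Finset.prod_mul_distrib (f := fun k : Fin H => π k (τ.1 k.castSucc) (τ.2 k) *
    M.P k (τ.1 k.castSucc) (τ.2 k) (τ.1 k.succ)), Finset.prod_ite_eq' Finset.univ h,
    if_pos (Finset.mem_univ _), ← mul_assoc]

lemma occ_nonneg (h : Fin H) (s : S) (a : A) : 0 ≤ occ M π h s a := by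
  unfold occ
  refine Finset.sum_nonneg fun τ _ => ?_
  split_ifs
  · exact trajProb_nonneg M π τ
  · exact le_rfl

lemma occ_sum (h : Fin H) : ∑ s, ∑ a, occ M π h s a = 1 := by
  have := trajExp_stateAction M π h fun _ _ => 1
  rw [trajExp_const] at this
  simpa [expect] using this.symm

lemma expect_mono {d g g' : S → A → ℝ} (hd : ∀ s a, 0 ≤ d s a) (h : ∀ s a, g s a ≤ g' s a) :
    expect d g ≤ expect d g' :=
  Finset.sum_le_sum fun s _ => Finset.sum_le_sum fun a _ =>
    mul_le_mul_of_nonneg_left (h s a) (hd s a)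

lemma expect_nonneg {d g : S → A → ℝ} (hd : ∀ s a, 0 ≤ d s a) (h : ∀ s a, 0 ≤ g s a) :
    0 ≤ expect d g :=
  Finset.sum_nonneg fun s _ => Finset.sum_nonneg fun a _ => mul_nonneg (hd s a) (h s a)

lemma expect_occ_const (h : Fin H) (c : ℝ) : expect (occ M π h) (fun _ _ => c) = c := by
  unfold expect
  simp only [← Finset.sum_mul, occ_sum, one_mul]

lemma expect_add (d g g' : S → A → ℝ) :
    expect d (fun s a => g s a + g' s a) = expect d g + expect d g' := by
  simp only [expect, mul_add, Finset.sum_add_distrib]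

lemma expect_const_mul (d g : S → A → ℝ) (c : ℝ) :
    expect d (fun s a => c * g s a) = c * expect d g := by
  simp only [expect, Finset.mul_sum]
  exact Finset.sum_congr rfl fun s _ => Finset.sum_congr rfl fun a _ => by ring

lemma expect_eq_sum_prod (d g : S → A → ℝ) :
    expect d g = ∑ x : S × A, d x.1 x.2 * g x.1 x.2 := by
  rw [Fintype.sum_prod_type]
  rfl

end Paths

/-! ### An elliptical potential bound -/

/-- The inequality `1 - 1/y ≤ log y` bounds `d / (1 + D + d)` by the increment of the logarithm. The
factor 3 comes from `1 + D + d ≤ 3 max(1, D)`. -/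
lemma div_max_one_le_log {D d : ℝ} (hD : 0 ≤ D) (hd : 0 ≤ d) (hd1 : d ≤ 1) :
    d / max 1 D ≤ 3 * (Real.log (1 + D + d) - Real.log (1 + D)) := by
  have h1 : 0 < 1 + D := by linarith
  have h2 : 0 < 1 + D + d := by linarith
  rw [← Real.log_div h2.ne' h1.ne']
  have hl := Real.one_sub_inv_le_log_of_pos (div_pos h2 h1)
  have he : 1 - ((1 + D + d) / (1 + D))⁻¹ = d / (1 + D + d) := by
    field_simp
    ring
  rw [he] at hl
  refine le_trans ?_ (mul_le_mul_of_nonneg_left hl (by norm_num))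
  have hm : 0 < max 1 D := lt_of_lt_of_le one_pos (le_max_left _ _)
  rw [← mul_div_assoc, div_le_div_iff₀ hm h2]
  have : 1 + D + d ≤ 3 * max 1 D := by
    have := le_max_left 1 D
    have := le_max_right 1 D
    linarith
  nlinarith

lemma sum_Iio_castSucc {n : ℕ} (t : Fin n) (f : Fin (n + 1) → ℝ) :
    ∑ i ∈ Finset.Iio t.castSucc, f i = ∑ i ∈ Finset.Iio t, f i.castSucc := by
  rw [← Fin.map_castSuccEmb_Iio, Finset.sum_map]
  rfl

lemma sum_Iio_last {n : ℕ} (f : Fin (n + 1) → ℝ) :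
    ∑ i ∈ Finset.Iio (Fin.last n), f i = ∑ i, f (Fin.castSucc i) := by
  have : Finset.Iio (Fin.last n) = Finset.univ.map Fin.castSuccEmb := by
    ext i
    simp only [Finset.mem_Iio, Finset.mem_map, Finset.mem_univ, true_and, Fin.coe_castSuccEmb]
    exact Fin.lt_last_iff_ne_last.trans Fin.exists_castSucc_eq.symm
  rw [this, Finset.sum_map]
  rfl

lemma sum_div_max_one_le {T : ℕ} (d : Fin T → ℝ) (hd : ∀ t, 0 ≤ d t) (hd1 : ∀ t, d t ≤ 1) :
    ∑ t, d t / max 1 (∑ i ∈ Finset.Iio t, d i) ≤ 3 * Real.log (1 + T) := by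
  have key : ∑ t, d t / max 1 (∑ i ∈ Finset.Iio t, d i) ≤ 3 * Real.log (1 + ∑ t, d t) := by
    induction T with
    | zero => simp
    | succ n ih =>
      rw [Fin.sum_univ_castSucc, Fin.sum_univ_castSucc (f := d), sum_Iio_last]
      simp only [sum_Iio_castSucc]
      have h1 := ih (fun t => d t.castSucc) (fun t => hd _) fun t => hd1 _
      have h2 := div_max_one_le_log (D := ∑ i : Fin n, d i.castSucc)
        (Finset.sum_nonneg fun i _ => hd _) (hd (Fin.last n)) (hd1 _)
      rw [← add_assoc]
      linarith
  refine key.trans (mul_le_mul_of_nonneg_left (Real.log_le_log ?_ ?_) (by norm_num))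
  · have := Finset.sum_nonneg fun i (_ : i ∈ Finset.univ) => hd i
    linarith
  · have := Finset.sum_le_sum fun i (_ : i ∈ Finset.univ) => hd1 i
    simp only [Finset.sum_const, Finset.card_univ, Fintype.card_fin, nsmul_eq_mul, mul_one] at this
    linarith

/-- A cumulative extrapolation bound: predictions on the distributions `d t` are controlled by the
squared errors on the earlier distributions, up to a factor `|s| log T`. -/
lemma sum_sq_div_max_le {X : Type*} (s : Finset X) {T : ℕ} {B : ℝ} (hB : 0 < B)
    (d g : Fin T → X → ℝ) (hd : ∀ t x, 0 ≤ d t x) (hd1 : ∀ t, ∑ x ∈ s, d t x ≤ 1)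
    (hg : ∀ t, ∀ x ∈ s, |g t x| ≤ 2 * B) :
    ∑ t, (∑ x ∈ s, d t x * g t x) ^ 2 /
        max (B ^ 2) (∑ i ∈ Finset.Iio t, ∑ x ∈ s, d i x * g t x ^ 2) ≤
      24 * (s.card * Real.log (1 + T)) := by
  classical
  set D : Fin T → X → ℝ := fun t x => ∑ i ∈ Finset.Iio t, d i x with hDdef
  have hD : ∀ t x, 0 ≤ D t x := fun t x => Finset.sum_nonneg fun i _ => hd i x
  have hterm : ∀ t, (∑ x ∈ s, d t x * g t x) ^ 2 /
        max (B ^ 2) (∑ i ∈ Finset.Iio t, ∑ x ∈ s, d i x * g t x ^ 2) ≤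
      8 * ∑ x ∈ s, d t x / max 1 (D t x) := by
    intro t
    have hB2 : 0 < B ^ 2 := by positivity
    have hE : ∑ i ∈ Finset.Iio t, ∑ x ∈ s, d i x * g t x ^ 2 = ∑ x ∈ s, D t x * g t x ^ 2 := by
      rw [Finset.sum_comm]
      simp only [hDdef, Finset.sum_mul]
    rw [hE]
    set E := ∑ x ∈ s, D t x * g t x ^ 2
    set W := max (B ^ 2) E
    have hW : 0 < W := lt_of_lt_of_le hB2 (le_max_left _ _)
    rw [div_le_iff₀ hW]
    -- Cells with accumulated weight below 1 carry too little data and are charged with the sup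
    -- bound `2B`. The other cells are charged with the squared error through Cauchy–Schwarz.
    rw [← Finset.sum_filter_add_sum_filter_not s (fun x => D t x < 1) fun x => d t x * g t x,
      ← Finset.sum_filter_add_sum_filter_not s (fun x => D t x < 1) fun x => d t x / max 1 (D t x)]
    set s₁ := s.filter fun x => D t x < 1
    set s₂ := s.filter fun x => ¬ D t x < 1
    have hs₁ : s₁ ⊆ s := Finset.filter_subset _ _
    have hs₂ : s₂ ⊆ s := Finset.filter_subset _ _
    have e₁ : ∑ x ∈ s₁, d t x / max 1 (D t x) = ∑ x ∈ s₁, d t x :=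
      Finset.sum_congr rfl fun x hx => by
        rw [max_eq_left (Finset.mem_filter.1 hx).2.le, div_one]
    have e₂ : ∑ x ∈ s₂, d t x / max 1 (D t x) = ∑ x ∈ s₂, d t x / D t x :=
      Finset.sum_congr rfl fun x hx => by
        rw [max_eq_right (not_lt.1 (Finset.mem_filter.1 hx).2)]
    rw [e₁, e₂]
    set a := ∑ x ∈ s₁, d t x * g t x
    set b := ∑ x ∈ s₂, d t x * g t x
    set p := ∑ x ∈ s₁, d t x
    set q := ∑ x ∈ s₂, d t x / D t x
    have hp0 : 0 ≤ p := Finset.sum_nonneg fun x _ => hd t x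
    have hp1 : p ≤ 1 :=
      (Finset.sum_le_sum_of_subset_of_nonneg hs₁ fun x _ _ => hd t x).trans (hd1 t)
    have hq0 : 0 ≤ q := Finset.sum_nonneg fun x _ => div_nonneg (hd t x) (hD t x)
    have ha : |a| ≤ 2 * B * p := by
      refine (Finset.abs_sum_le_sum_abs _ _).trans ?_
      rw [Finset.mul_sum]
      refine Finset.sum_le_sum fun x hx => ?_
      rw [abs_mul, abs_of_nonneg (hd t x), mul_comm]
      exact mul_le_mul_of_nonneg_right (hg t x (hs₁ hx)) (hd t x)
    -- Since `p ≤ 1`, the square `p²` is at most `p`, which makes the bound linear in the potential.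
    have ha2 : a ^ 2 ≤ 4 * p * W := by
      have h1 : a ^ 2 ≤ (2 * B * p) ^ 2 := sq_le_sq' (abs_le.1 ha).1 (abs_le.1 ha).2
      have h2 : (2 * B * p) ^ 2 ≤ 4 * p * B ^ 2 := by
        have : p ^ 2 ≤ p := by nlinarith
        nlinarith
      have h3 : 4 * p * B ^ 2 ≤ 4 * p * W :=
        mul_le_mul_of_nonneg_left (le_max_left _ _) (by linarith)
      linarith
    -- Cauchy–Schwarz with weights `d / D` and `D g²`, whose product `d g²` dominates `(d g)²`
    -- because `d ≤ 1`.
    have hb2 : b ^ 2 ≤ q * W := by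
      have h1 : b ^ 2 ≤ (∑ x ∈ s₂, d t x / D t x) * ∑ x ∈ s₂, D t x * g t x ^ 2 := by
        refine Finset.sum_sq_le_sum_mul_sum_of_sq_le_mul _ (fun x _ => div_nonneg (hd t x) (hD t x))
          (fun x _ => mul_nonneg (hD t x) (sq_nonneg _)) fun x hx => ?_
        have hDx : 1 ≤ D t x := not_lt.1 (Finset.mem_filter.1 hx).2
        have hdx : d t x ≤ 1 :=
          (Finset.single_le_sum (f := d t) (fun y _ => hd t y) (hs₂ hx)).trans (hd1 t)
        have : d t x / D t x * (D t x * g t x ^ 2) = d t x * g t x ^ 2 := by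
          field_simp
        rw [this, mul_pow]
        exact mul_le_mul_of_nonneg_right (by nlinarith [hd t x]) (sq_nonneg _)
      have h2 : ∑ x ∈ s₂, D t x * g t x ^ 2 ≤ W :=
        (Finset.sum_le_sum_of_subset_of_nonneg hs₂
          fun x _ _ => mul_nonneg (hD t x) (sq_nonneg _)).trans (le_max_right _ _)
      exact h1.trans (mul_le_mul_of_nonneg_left h2 hq0)
    -- `(a + b)² ≤ 2a² + 2b² ≤ 8pW + 2qW`, hence the factor 8. With the factor 3 of the logarithmic
    -- potential it makes 24.
    nlinarith [sq_nonneg (a - b)]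
  refine (Finset.sum_le_sum fun t _ => hterm t).trans ?_
  rw [← Finset.mul_sum, Finset.sum_comm]
  have hx : ∀ x ∈ s, ∑ t, d t x / max 1 (D t x) ≤ 3 * Real.log (1 + T) := fun x hx =>
    sum_div_max_one_le (fun t => d t x) (fun t => hd t x) fun t =>
      (Finset.single_le_sum (f := d t) (fun y _ => hd t y) hx).trans (hd1 t)
  have := Finset.sum_le_sum hx
  rw [Finset.sum_const, nsmul_eq_mul] at this
  linarith

/-! ### The complexity measures -/

section Complexity

variable {S A : Type*} [Fintype S] [Fintype A] {H : ℕ} (M : MDP S A H)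

lemma nextQ_mem {f : QFun S A H} (hf : f ∈ qClass S A H) (h : Fin H) :
    nextQ f h ∈ stepClass S A H := by
  unfold nextQ
  split_ifs
  · exact hf _
  · exact fun s a => ⟨le_rfl, Nat.cast_nonneg _⟩

lemma iSup_mem_Icc [Nonempty A] {g : S → A → ℝ} (hg : g ∈ stepClass S A H) (s : S) :
    ⨆ a, g s a ∈ Set.Icc (0 : ℝ) H :=
  ⟨Real.iSup_nonneg fun a => (hg s a).1, ciSup_le fun a => (hg s a).2⟩

lemma bellman_mem [Nonempty A] {g : S → A → ℝ} (hg : g ∈ stepClass S A H) (h : Fin H) (s : S)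
    (a : A) : bellman M h g s a ∈ Set.Icc (0 : ℝ) (H + 1) := by
  unfold bellman
  have hR := M.R_mem h s a
  have h1 : 0 ≤ ∑ s', M.P h s a s' * ⨆ a', g s' a' := Finset.sum_nonneg fun s' _ =>
    mul_nonneg (kernel_nonneg M h s a s') (iSup_mem_Icc hg s').1
  have h2 : ∑ s', M.P h s a s' * ⨆ a', g s' a' ≤ H := by
    refine (Finset.sum_le_sum fun s' _ =>
      mul_le_mul_of_nonneg_left (iSup_mem_Icc hg s').2 (kernel_nonneg M h s a s')).trans ?_
    rw [← Finset.sum_mul, kernel_sum, one_mul]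
  exact ⟨by linarith [hR.1], by linarith [hR.2]⟩

lemma abs_bellmanErr_le [Nonempty A] {f : QFun S A H} (hf : f ∈ qClass S A H) (h : Fin H) (s : S)
    (a : A) : |bellmanErr M f h s a| ≤ 2 * H := by
  have hH : (1 : ℝ) ≤ H := by exact_mod_cast h.pos
  have h1 := hf h s a
  have h2 := bellman_mem M (nextQ_mem hf h) h s a
  unfold bellmanErr
  rw [abs_le]
  exact ⟨by linarith [h1.1, h2.2], by linarith [h1.2, h2.1]⟩

/-- Outside `X` the numerator is 0, and `0 / 0 = 0`, so the extra points add nothing to the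
supremum. -/
lemma ratioSup_eq_ratioNorm (πoff : Policy S A H) (X : Set (S × A × Fin H)) :
    ratioSup M πoff X = ratioNorm M πoff X := by
  unfold ratioSup ratioNorm
  refine iSup_congr fun π => iSup_congr fun x => ?_
  by_cases hx : x ∈ X <;> simp [hx]

/-- A finite ratio forces `d^π` to vanish wherever `μ` does, so the denominator can be cleared even
at cells of zero mass. -/
lemma occ_le_ratioSup_mul (πoff π : Policy S A H) (X : Set (S × A × Fin H)) {s : S} {a : A}
    {h : Fin H} (hx : (s, a, h) ∈ X) (hr : ratioSup M πoff X ≠ ⊤) :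
    ENNReal.ofReal (occ M π h s a) ≤
      ratioSup M πoff X * ENNReal.ofReal (occ M πoff h s a) := by
  have h1 : ENNReal.ofReal (occ M π h s a) / ENNReal.ofReal (occ M πoff h s a) ≤
      ratioSup M πoff X :=
    le_iSup_of_le π <| le_iSup_of_le (s, a, h) <| le_iSup_of_le hx le_rfl
  by_cases h0 : ENNReal.ofReal (occ M πoff h s a) = 0
  · rw [h0] at h1 ⊢
    by_cases h0' : ENNReal.ofReal (occ M π h s a) = 0
    · simp [h0']
    · rw [ENNReal.div_zero h0', top_le_iff] at h1
      exact absurd h1 hr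
  · exact (ENNReal.div_le_iff h0 ENNReal.ofReal_ne_top).1 h1

lemma occ_le_toReal_ratioSup_mul (πoff π : Policy S A H) (X : Set (S × A × Fin H)) {s : S} {a : A}
    {h : Fin H} (hx : (s, a, h) ∈ X) (hr : ratioSup M πoff X ≠ ⊤) :
    occ M π h s a ≤ (ratioSup M πoff X).toReal * occ M πoff h s a := by
  have := occ_le_ratioSup_mul M πoff π X hx hr
  rwa [← ENNReal.ofReal_toReal hr, ← ENNReal.ofReal_mul ENNReal.toReal_nonneg,
    ENNReal.ofReal_le_ofReal_iff (mul_nonneg ENNReal.toReal_nonneg (occ_nonneg M πoff h s a))]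
    at this

lemma expect_restrErr_sq_le (πoff π : Policy S A H) (X : Set (S × A × Fin H))
    (hr : ratioSup M πoff X ≠ ⊤) (f : QFun S A H) (h : Fin H) :
    expect (occ M π h) (fun s a => restrErr M X f h s a ^ 2) ≤
      (ratioSup M πoff X).toReal * expect (occ M πoff h) fun s a => restrErr M X f h s a ^ 2 := by
  unfold expect
  simp only [Finset.mul_sum]
  refine Finset.sum_le_sum fun s _ => Finset.sum_le_sum fun a _ => ?_
  by_cases hx : (s, a, h) ∈ X
  · rw [← mul_assoc]
    exact mul_le_mul_of_nonneg_right (occ_le_toReal_ratioSup_mul M πoff π X hx hr) (sq_nonneg _)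
  · simp [restrErr, hx]

lemma cOff_le_ratioSup (πoff : Policy S A H) (X : Set (S × A × Fin H)) :
    cOff M πoff X ≤ ratioSup M πoff X := by
  by_cases hr : ratioSup M πoff X = ⊤
  · simp [hr]
  · refine iSup_le fun h => iSup₂_le fun f _ => iSup_le fun π => ?_
    refine ENNReal.div_le_of_le_mul ?_
    rw [← ENNReal.ofReal_toReal hr, ← ENNReal.ofReal_mul ENNReal.toReal_nonneg]
    exact ENNReal.ofReal_le_ofReal (expect_restrErr_sq_le M πoff π X hr f h)

open Classical in
/-- The state-action pairs `(s, a)` with `(s, a, h) ∈ X`. -/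
def sliceFinset (X : Set (S × A × Fin H)) (h : Fin H) : Finset (S × A) :=
  Finset.univ.filter fun p => (p.1, p.2, h) ∈ X

lemma mem_sliceFinset {X : Set (S × A × Fin H)} {h : Fin H} {p : S × A} :
    p ∈ sliceFinset X h ↔ (p.1, p.2, h) ∈ X := by
  simp [sliceFinset]

lemma card_sliceFinset_le (X : Set (S × A × Fin H)) (h : Fin H) :
    (sliceFinset X h).card ≤ maxSlice X := by
  have : (sliceFinset X h).card = {p : S × A | (p.1, p.2, h) ∈ X}.ncard := by
    rw [← Set.ncard_coe_finset]
    congr 1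
    ext p
    simp [mem_sliceFinset]
  rw [this]
  exact Finset.le_sup (f := fun h : Fin H => {p : S × A | (p.1, p.2, h) ∈ X}.ncard)
    (Finset.mem_univ h)

lemma sum_occ_le_one (π : Policy S A H) (h : Fin H) (s : Finset (S × A)) :
    ∑ x ∈ s, occ M π h x.1 x.2 ≤ 1 := by
  refine (Finset.sum_le_sum_of_subset_of_nonneg (Finset.subset_univ s)
    fun x _ _ => occ_nonneg M π h x.1 x.2).trans ?_
  rw [Fintype.sum_prod_type, occ_sum]

lemma expect_eq_sum_slice (X : Set (S × A × Fin H)) (d g : S → A → ℝ) (h : Fin H)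
    (hg : ∀ s a, (s, a, h) ∉ X → g s a = 0) :
    expect d g = ∑ x ∈ sliceFinset X h, d x.1 x.2 * g x.1 x.2 := by
  rw [expect_eq_sum_prod]
  refine (Finset.sum_subset (Finset.subset_univ _) fun x _ hx => ?_).symm
  rw [hg _ _ fun h => hx (mem_sliceFinset.2 h), mul_zero]

lemma cOn_le [Nonempty A] (X : Set (S × A × Fin H)) {T : ℕ} (hT : 2 ≤ T) {C : ℝ} (hC : 48 ≤ C) :
    cOn M X T ≤ ENNReal.ofReal (C * (maxSlice X * Real.log T)) := by
  refine iSup_le fun h => iSup_le fun f => iSup_le fun hf => iSup_le fun π => ?_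
  refine ENNReal.ofReal_le_ofReal ?_
  have hH : (0 : ℝ) < H := by exact_mod_cast h.pos
  have h0 : ∀ t s a, (s, a, h) ∉ X → restrErr M X (f t) h s a = 0 := fun t s a hx => by
    simp [restrErr, hx]
  have key := sum_sq_div_max_le (sliceFinset X h) hH (fun t x => occ M (π t) h x.1 x.2)
    (fun t x => restrErr M X (f t) h x.1 x.2) (fun t x => occ_nonneg M (π t) h x.1 x.2)
    (fun t => sum_occ_le_one M (π t) h _) fun t x hx => by
      rw [restrErr, Set.indicator_of_mem (mem_sliceFinset.1 hx)]
      exact abs_bellmanErr_le M (hf t) h x.1 x.2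
  have e1 : ∀ t, expect (occ M (π t) h) (restrErr M X (f t) h) =
      ∑ x ∈ sliceFinset X h, occ M (π t) h x.1 x.2 * restrErr M X (f t) h x.1 x.2 :=
    fun t => expect_eq_sum_slice X _ _ h (h0 t)
  have e2 : ∀ t i, expect (occ M (π i) h) (fun s a => restrErr M X (f t) h s a ^ 2) =
      ∑ x ∈ sliceFinset X h, occ M (π i) h x.1 x.2 * restrErr M X (f t) h x.1 x.2 ^ 2 :=
    fun t i => expect_eq_sum_slice X _ _ h fun s a hx => by rw [h0 t s a hx]; norm_num
  simp only [e1, e2]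
  refine key.trans ?_
  have hT' : (2 : ℝ) ≤ T := by exact_mod_cast hT
  -- `1 + T ≤ T²` for `T ≥ 2`; this doubles 24 to 48.
  have hlog : Real.log (1 + T) ≤ 2 * Real.log T := by
    rw [← Real.log_rpow (by linarith)]
    refine Real.log_le_log (by linarith) ?_
    norm_num
    nlinarith
  have hlog0 : 0 ≤ Real.log T := Real.log_nonneg (by linarith)
  have hlog1 : 0 ≤ Real.log (1 + T) := Real.log_nonneg (by linarith)
  have hcard : ((sliceFinset X h).card : ℝ) ≤ maxSlice X := by
    exact_mod_cast card_sliceFinset_le X h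
  calc 24 * (((sliceFinset X h).card : ℝ) * Real.log (1 + T))
      ≤ 24 * ((maxSlice X : ℝ) * (2 * Real.log T)) := by gcongr
    _ = 48 * (maxSlice X * Real.log T) := by ring
    _ ≤ C * (maxSlice X * Real.log T) := by gcongr

end Complexity

/-! ### Adaptively collected data -/

section Adaptive

/-- The first `t` entries of a finite sequence. -/
def history {Ω : Type*} {n : ℕ} (ω : Fin n → Ω) (t : Fin n) : Fin (t : ℕ) → Ω :=
  fun i => ω (Fin.castLE t.isLt.le i)

variable {Ω : Type*} [Fintype Ω] (w : (t : ℕ) → (Fin t → Ω) → Ω → ℝ)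

/-- The weights of earlier entries do not see the last one, so the last entry can be summed out
first. This is the tower property for adaptively collected data. -/
lemma sum_prod_history_succ (n : ℕ) :
    ∑ ω : Fin (n + 1) → Ω, ∏ t : Fin (n + 1), w t (history ω t) (ω t) =
      ∑ ω : Fin n → Ω, (∏ t : Fin n, w t (history ω t) (ω t)) * ∑ τ, w n ω τ := by
  rw [← Equiv.sum_comp (Fin.snocEquiv fun _ => Ω), Fintype.sum_prod_type, Finset.sum_comm]
  refine Finset.sum_congr rfl fun ω _ => ?_
  rw [Finset.mul_sum]
  refine Finset.sum_congr rfl fun τ _ => ?_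
  rw [Fin.prod_univ_castSucc]
  congr 1
  · refine Finset.prod_congr rfl fun t _ => ?_
    have h1 : history ((Fin.snocEquiv fun _ => Ω) (τ, ω)) t.castSucc = history ω t := by
      funext i
      exact Fin.snoc_castSucc (α := fun _ => Ω) τ ω (Fin.castLE t.isLt.le i)
    have h2 : (Fin.snocEquiv fun _ => Ω) (τ, ω) t.castSucc = ω t :=
      Fin.snoc_castSucc (α := fun _ => Ω) τ ω t
    rw [h1, h2]
    rfl
  · have h1 : history ((Fin.snocEquiv fun _ => Ω) (τ, ω)) (Fin.last n) = ω := by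
      funext i
      exact Fin.snoc_castSucc (α := fun _ => Ω) τ ω i
    have h2 : (Fin.snocEquiv fun _ => Ω) (τ, ω) (Fin.last n) = τ :=
      Fin.snoc_last (α := fun _ => Ω) τ ω
    rw [h1, h2]
    rfl

lemma sum_prod_history_le_one (h0 : ∀ t ω τ, 0 ≤ w t ω τ) (h1 : ∀ t ω, ∑ τ, w t ω τ ≤ 1) (n : ℕ) :
    ∑ ω : Fin n → Ω, ∏ t : Fin n, w t (history ω t) (ω t) ≤ 1 := by
  induction n with
  | zero => simp
  | succ n ih =>
    rw [sum_prod_history_succ]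
    exact (Finset.sum_le_sum fun ω _ => mul_le_of_le_one_right
      (Finset.prod_nonneg fun t _ => h0 _ _ _) (h1 n ω)).trans ih

lemma sum_prod_history_eq_one (h1 : ∀ t ω, ∑ τ, w t ω τ = 1) (n : ℕ) :
    ∑ ω : Fin n → Ω, ∏ t : Fin n, w t (history ω t) (ω t) = 1 := by
  induction n with
  | zero => simp
  | succ n ih =>
    rw [sum_prod_history_succ]
    simpa only [h1, mul_one] using ih

lemma sum_castLE_eq_sum_Iio {n : ℕ} (t : Fin n) (f : Fin n → ℝ) :
    ∑ i : Fin (t : ℕ), f (Fin.castLE t.isLt.le i) = ∑ i ∈ Finset.Iio t, f i := by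
  have : Finset.Iio t = Finset.univ.map (Fin.castLEEmb t.isLt.le) := by
    ext i
    simp only [Finset.mem_Iio, Finset.mem_map, Finset.mem_univ, true_and, Fin.castLEEmb_apply]
    exact ⟨fun h => ⟨⟨i, h⟩, rfl⟩, fun ⟨j, hj⟩ => hj ▸ j.2⟩
  rw [this, Finset.sum_map]
  rfl

end Adaptive

/-! ### The law of a run of the learner, and least-squares concentration under it. -/

section Run

variable {S A : Type*} [Fintype S] [Fintype A] {H : ℕ} (M : MDP S A H) (πoff : Policy S A H)
  {Noff Non : ℕ} (L : Learner S A H Noff)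

lemma runProb_nonneg (ω : (Fin Noff → Traj S A H) × (Fin Non → Traj S A H)) :
    0 ≤ runProb M πoff L ω :=
  mul_nonneg (Finset.prod_nonneg fun _ _ => trajProb_nonneg M _ _)
    (Finset.prod_nonneg fun _ _ => trajProb_nonneg M _ _)

lemma sum_runProb :
    ∑ ω : (Fin Noff → Traj S A H) × (Fin Non → Traj S A H), runProb M πoff L ω = 1 := by
  rw [Fintype.sum_prod_type]
  unfold runProb
  simp only [← Finset.mul_sum]
  have h1 : ∀ off : Fin Noff → Traj S A H, ∑ on : Fin Non → Traj S A H,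
      ∏ t, trajProb M (playedPolicy L (off, on) t) (on t) = 1 := fun off =>
    sum_prod_history_eq_one (fun t on τ => trajProb M (L t off on) τ)
      (fun t on => sum_trajProb M _) Non
  simp only [h1, mul_one]
  exact sum_prod_history_eq_one (fun t on τ => trajProb M πoff τ)
      (fun t on => sum_trajProb M _) Noff

/-- The supermartingale property: each factor has conditional mean at most 1 given the past. The
online episodes are summed out for fixed offline data, then the offline ones. -/
lemma sum_runProb_mul_prod_le_one (e : Traj S A H → ℝ)
    (e' : (t : ℕ) → (Fin Noff → Traj S A H) → (Fin t → Traj S A H) → Traj S A H → ℝ)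
    (he : ∀ τ, 0 ≤ e τ) (he' : ∀ t off on τ, 0 ≤ e' t off on τ)
    (h : trajExp M πoff e ≤ 1) (h' : ∀ t off on, trajExp M (L t off on) (e' t off on) ≤ 1) :
    ∑ ω : (Fin Noff → Traj S A H) × (Fin Non → Traj S A H), runProb M πoff L ω *
      ((∏ i, e (ω.1 i)) * ∏ t : Fin Non, e' t ω.1 (history ω.2 t) (ω.2 t)) ≤ 1 := by
  have h1 : ∀ off : Fin Noff → Traj S A H, ∑ on : Fin Non → Traj S A H,
      ∏ t, (trajProb M (playedPolicy L (off, on) t) (on t) * e' t off (history on t) (on t)) ≤ 1 :=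
    fun off => sum_prod_history_le_one (fun t on τ => trajProb M (L t off on) τ * e' t off on τ)
      (fun t on τ => mul_nonneg (trajProb_nonneg M _ _) (he' _ _ _ _))
      (fun t on => h' t off on) Non
  have h2 : ∑ off : Fin Noff → Traj S A H, ∏ i, (trajProb M πoff (off i) * e (off i)) ≤ 1 :=
    sum_prod_history_le_one (fun t on τ => trajProb M πoff τ * e τ)
      (fun t on τ => mul_nonneg (trajProb_nonneg M _ _) (he _)) (fun t on => h) Noff
  rw [Fintype.sum_prod_type]
  refine le_trans (Finset.sum_le_sum fun off _ => ?_) h2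
  calc _ = (∏ i, (trajProb M πoff (off i) * e (off i))) * ∑ on : Fin Non → Traj S A H,
      ∏ t, (trajProb M (playedPolicy L (off, on) t) (on t) * e' t off (history on t) (on t)) := by
        rw [Finset.mul_sum]
        refine Finset.sum_congr rfl fun on _ => ?_
        simp only [runProb, Finset.prod_mul_distrib]
        ring
    _ ≤ _ := mul_le_of_le_one_right
        (Finset.prod_nonneg fun i _ => mul_nonneg (trajProb_nonneg M _ _) (he _)) (h1 off)

/-! ### Least squares with a clipped Bellman backup -/

/-- The Bellman backup, clipped to `[0, H]`. -/
def clipBellman (h : Fin H) (g : S → A → ℝ) (s : S) (a : A) : ℝ := min (bellman M h g s a) H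

/-- The deviation of `g` from the clipped Bellman backup of `g'`. -/
def clipErr (h : Fin H) (g g' : S → A → ℝ) (s : S) (a : A) : ℝ := g s a - clipBellman M h g' s a

/-- The excess loss of `g` over the clipped Bellman backup of `g'`, on one trajectory. -/
def excess (h : Fin H) (g g' : S → A → ℝ) (τ : Traj S A H) : ℝ :=
  stepLoss M h g g' τ - stepLoss M h (clipBellman M h g') g' τ

/-- The unclipped backup can reach `H + 1` and leave the class. The clipped one stays inside, so it
is an admissible competitor in the definition of the confidence set. -/
lemma clipBellman_mem [Nonempty A] {g : S → A → ℝ} (hg : g ∈ stepClass S A H) (h : Fin H) :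
    clipBellman M h g ∈ stepClass S A H := fun s a =>
  ⟨le_min (bellman_mem M hg h s a).1 (Nat.cast_nonneg _), min_le_right _ _⟩

lemma abs_clipErr_le [Nonempty A] {g g' : S → A → ℝ} (hg : g ∈ stepClass S A H)
    (hg' : g' ∈ stepClass S A H) (h : Fin H) (s : S) (a : A) : |clipErr M h g g' s a| ≤ H := by
  have h1 := hg s a
  have h2 := clipBellman_mem M hg' h s a
  unfold clipErr
  rw [abs_le]
  exact ⟨by linarith [h1.1, h2.2], by linarith [h1.2, h2.1]⟩

lemma target_mem [Nonempty A] {g : S → A → ℝ} (hg : g ∈ stepClass S A H) (h : Fin H) (s : S) (a : A)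
    (s' : S) : M.R h s a + ⨆ a', g s' a' ∈ Set.Icc (0 : ℝ) (2 * H) := by
  have hH : (1 : ℝ) ≤ H := by exact_mod_cast h.pos
  have h1 := M.R_mem h s a
  have h2 := iSup_mem_Icc hg s'
  exact ⟨by linarith [h1.1, h2.1], by linarith [h1.2, h2.2]⟩

lemma excess_eq (h : Fin H) (g g' : S → A → ℝ) (τ : Traj S A H) :
    excess M h g g' τ = clipErr M h g g' (τ.1 h.castSucc) (τ.2 h) *
      (g (τ.1 h.castSucc) (τ.2 h) + clipBellman M h g' (τ.1 h.castSucc) (τ.2 h) -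
        2 * (M.R h (τ.1 h.castSucc) (τ.2 h) + ⨆ a', g' (τ.1 h.succ) a')) := by
  unfold excess stepLoss clipErr
  ring

lemma abs_excess_le [Nonempty A] {g g' : S → A → ℝ} (hg : g ∈ stepClass S A H)
    (hg' : g' ∈ stepClass S A H) (h : Fin H) (τ : Traj S A H) :
    |excess M h g g' τ| ≤ 4 * H * |clipErr M h g g' (τ.1 h.castSucc) (τ.2 h)| := by
  rw [excess_eq, abs_mul, mul_comm]
  refine mul_le_mul_of_nonneg_right ?_ (abs_nonneg _)
  have h1 := hg (τ.1 h.castSucc) (τ.2 h)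
  have h2 := clipBellman_mem M hg' h (τ.1 h.castSucc) (τ.2 h)
  have h3 := target_mem M hg' h (τ.1 h.castSucc) (τ.2 h) (τ.1 h.succ)
  rw [abs_le]
  exact ⟨by linarith [h1.1, h2.1, h3.2], by linarith [h1.2, h2.2, h3.1]⟩

/-- Given `(s, a)`, the mean excess is `c² + 2c (clipped backup - backup)`, where `c` is the clipped
error. The cross term is nonnegative: it is 0 when nothing is clipped; otherwise the clipped backup
equals `H`, which dominates `g`, so both factors are nonpositive. -/
lemma expect_clipErr_sq_le_trajExp_excess (π : Policy S A H) {g : S → A → ℝ}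
    (hg : g ∈ stepClass S A H) (g' : S → A → ℝ) (h : Fin H) :
    expect (occ M π h) (fun s a => clipErr M h g g' s a ^ 2) ≤ trajExp M π (excess M h g g') := by
  have h1 := trajExp_transition M π h fun s a s' => clipErr M h g g' s a *
      (g s a + clipBellman M h g' s a - 2 * (M.R h s a + ⨆ a', g' s' a'))
  rw [funext (excess_eq M h g g'), h1]
  refine expect_mono (occ_nonneg M π h) fun s a => ?_
  have h2 : ∑ s', M.P h s a s' * (clipErr M h g g' s a *
      (g s a + clipBellman M h g' s a - 2 * (M.R h s a + ⨆ a', g' s' a'))) =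
      clipErr M h g g' s a * (g s a + clipBellman M h g' s a - 2 * bellman M h g' s a) := by
    have : ∀ s', M.P h s a s' * (clipErr M h g g' s a *
        (g s a + clipBellman M h g' s a - 2 * (M.R h s a + ⨆ a', g' s' a'))) =
        M.P h s a s' * (clipErr M h g g' s a * (g s a + clipBellman M h g' s a - 2 * M.R h s a)) -
        2 * clipErr M h g g' s a * (M.P h s a s' * ⨆ a', g' s' a') := fun s' => by ring
    simp only [this, Finset.sum_sub_distrib, ← Finset.sum_mul, ← Finset.mul_sum, kernel_sum]
    unfold bellman
    ring
  rw [h2]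
  have h3 : 0 ≤ clipErr M h g g' s a * (clipBellman M h g' s a - bellman M h g' s a) := by
    unfold clipErr clipBellman
    rcases le_total (bellman M h g' s a) H with hb | hb
    · simp [min_eq_left hb]
    · rw [min_eq_right hb]
      exact mul_nonneg_of_nonpos_of_nonpos (by linarith [(hg s a).2]) (by linarith)
  have h4 : clipErr M h g g' s a * (g s a + clipBellman M h g' s a - 2 * bellman M h g' s a) =
      clipErr M h g g' s a ^ 2 +
        2 * (clipErr M h g g' s a * (clipBellman M h g' s a - bellman M h g' s a)) := by
    unfold clipErr
    ring
  rw [h4]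
  linarith

/-- A Bernstein argument in which the mean of the excess dominates its second moment up to a
multiple of `H²`. Half of the mean pays for the second-order term of the exponential, and the other
half survives. -/
lemma trajExp_exp_le_one [Nonempty A] (π : Policy S A H) {g g' : S → A → ℝ}
    (hg : g ∈ stepClass S A H) (hg' : g' ∈ stepClass S A H) (h : Fin H) :
    trajExp M π (fun τ => Real.exp ((32 * (H : ℝ) ^ 2)⁻¹ *
      (expect (occ M π h) (fun s a => clipErr M h g g' s a ^ 2) / 2 - excess M h g g' τ))) ≤ 1 := by
  have hH : (1 : ℝ) ≤ H := by exact_mod_cast h.pos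
  set l : ℝ := (32 * (H : ℝ) ^ 2)⁻¹ with hl
  have hl0 : 0 < l := by positivity
  have hlH : l * (32 * (H : ℝ) ^ 2) = 1 := inv_mul_cancel₀ (by positivity)
  set E := expect (occ M π h) fun s a => clipErr M h g g' s a ^ 2 with hE
  have hpt : ∀ τ, Real.exp (-(l * excess M h g g' τ)) ≤
      1 - l * excess M h g g' τ + l / 2 * clipErr M h g g' (τ.1 h.castSucc) (τ.2 h) ^ 2 := by
    intro τ
    have hX := abs_excess_le M hg hg' h τ
    have hc := abs_clipErr_le M hg hg' h (τ.1 h.castSucc) (τ.2 h)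
    set x := excess M h g g' τ
    set c := clipErr M h g g' (τ.1 h.castSucc) (τ.2 h)
    -- `l |x| ≤ 4H² / (32H²) ≤ 1`, the range in which `exp y ≤ 1 + y + y²` is used.
    have hx1 : |-(l * x)| ≤ 1 := by
      rw [abs_neg, abs_mul, abs_of_pos hl0, ← hlH]
      refine mul_le_mul_of_nonneg_left ?_ hl0.le
      nlinarith [abs_nonneg c]
    have hexp := (abs_le.1 (Real.abs_exp_sub_one_sub_id_le hx1)).2
    have hx2 : x ^ 2 ≤ 16 * (H : ℝ) ^ 2 * c ^ 2 := by
      rw [← sq_abs x, ← sq_abs c]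
      calc |x| ^ 2 ≤ (4 * H * |c|) ^ 2 := pow_le_pow_left₀ (abs_nonneg _) hX 2
        _ = _ := by ring
    have : (-(l * x)) ^ 2 ≤ l / 2 * c ^ 2 := by
      calc (-(l * x)) ^ 2 = l ^ 2 * x ^ 2 := by ring
        _ ≤ l ^ 2 * (16 * (H : ℝ) ^ 2 * c ^ 2) := mul_le_mul_of_nonneg_left hx2 (sq_nonneg _)
        _ = l * (l * (32 * (H : ℝ) ^ 2)) / 2 * c ^ 2 := by ring
        _ = _ := by rw [hlH, mul_one]
    linarith
  have h1 : trajExp M π (fun τ => Real.exp (-(l * excess M h g g' τ))) ≤ Real.exp (-(l / 2 * E)) := by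
    refine (trajExp_mono M π fun τ _ => hpt τ).trans ?_
    have h2 : trajExp M π (fun τ => 1 - l * excess M h g g' τ +
        l / 2 * clipErr M h g g' (τ.1 h.castSucc) (τ.2 h) ^ 2) =
        1 - l * trajExp M π (excess M h g g') + l / 2 * E := by
      rw [hE, ← trajExp_stateAction]
      have := sum_trajProb M π
      simp only [trajExp, mul_add, mul_sub, mul_one, Finset.sum_add_distrib,
        Finset.sum_sub_distrib, this, Finset.mul_sum]
      congr 1
      · congr 1
        exact Finset.sum_congr rfl fun τ _ => by ring
      · exact Finset.sum_congr rfl fun τ _ => by ring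
    rw [h2]
    have h3 := mul_le_mul_of_nonneg_left (expect_clipErr_sq_le_trajExp_excess M π hg g' h) hl0.le
    have h4 := Real.add_one_le_exp (-(l / 2 * E))
    linarith
  calc _ = Real.exp (l / 2 * E) * trajExp M π (fun τ => Real.exp (-(l * excess M h g g' τ))) := by
        unfold trajExp
        rw [Finset.mul_sum]
        refine Finset.sum_congr rfl fun τ _ => ?_
        rw [mul_left_comm, ← Real.exp_add]
        ring_nf
    _ ≤ Real.exp (l / 2 * E) * Real.exp (-(l / 2 * E)) :=
        mul_le_mul_of_nonneg_left h1 (Real.exp_pos _).le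
    _ = 1 := by rw [← Real.exp_add, add_neg_cancel, Real.exp_zero]

/-- The expected value of `u ^ 2` at step `h`, summed over the offline episodes and the online
episodes before episode `t`. -/
def dataErr (ω : (Fin Noff → Traj S A H) × (Fin Non → Traj S A H)) (t : Fin Non) (h : Fin H)
    (u : S → A → ℝ) : ℝ :=
  Noff * expect (occ M πoff h) (fun s a => u s a ^ 2) +
    ∑ i ∈ Finset.Iio t, expect (occ M (playedPolicy L ω i) h) fun s a => u s a ^ 2

/-- The empirical excess loss of `g` over the clipped Bellman backup of `g'`. -/
def dataExcess (ω : (Fin Noff → Traj S A H) × (Fin Non → Traj S A H)) (t : Fin Non) (h : Fin H)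
    (g g' : S → A → ℝ) : ℝ :=
  loss M ω.1 (history ω.2 t) h g g' - loss M ω.1 (history ω.2 t) h (clipBellman M h g') g'

lemma dataExcess_eq (ω : (Fin Noff → Traj S A H) × (Fin Non → Traj S A H)) (t : Fin Non)
    (h : Fin H) (g g' : S → A → ℝ) :
    dataExcess M ω t h g g' =
      ∑ i, excess M h g g' (ω.1 i) + ∑ i ∈ Finset.Iio t, excess M h g g' (ω.2 i) := by
  rw [← sum_castLE_eq_sum_Iio]
  unfold dataExcess loss excess history
  simp only [Finset.sum_sub_distrib]
  ring

lemma probEvent_mono {E F : Set ((Fin Noff → Traj S A H) × (Fin Non → Traj S A H))} (h : E ⊆ F) :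
    probEvent M πoff L E ≤ probEvent M πoff L F :=
  Finset.sum_le_sum fun ω _ =>
    Set.indicator_le_indicator_of_subset h (fun ω => runProb_nonneg M πoff L ω) ω

lemma probEvent_compl (E : Set ((Fin Noff → Traj S A H) × (Fin Non → Traj S A H))) :
    probEvent M πoff L E = 1 - probEvent M πoff L Eᶜ := by
  rw [← sum_runProb M πoff L, eq_sub_iff_add_eq]
  unfold probEvent
  rw [← Finset.sum_add_distrib]
  exact Finset.sum_congr rfl fun ω _ => Set.indicator_self_add_compl_apply E _ ω

lemma probEvent_biUnion_le {ι : Type*} (s : Finset ι)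
    (E : ι → Set ((Fin Noff → Traj S A H) × (Fin Non → Traj S A H))) :
    probEvent M πoff L (⋃ i ∈ s, E i) ≤ ∑ i ∈ s, probEvent M πoff L (E i) := by
  unfold probEvent
  rw [Finset.sum_comm]
  refine Finset.sum_le_sum fun ω _ => ?_
  have h0 : ∀ i ∈ s, 0 ≤ (E i).indicator (runProb M πoff L) ω := fun i _ =>
    Set.indicator_nonneg (fun ω _ => runProb_nonneg M πoff L ω) ω
  by_cases hω : ω ∈ ⋃ i ∈ s, E i
  · obtain ⟨i, hi, hωi⟩ := Set.mem_iUnion₂.1 hω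
    rw [Set.indicator_of_mem hω]
    refine le_trans (le_of_eq ?_) (Finset.single_le_sum h0 hi)
    rw [Set.indicator_of_mem hωi]
  · rw [Set.indicator_of_notMem hω]
    exact Finset.sum_nonneg h0

/-- With high probability the expected squared error on the data is bounded by the empirical excess
loss. -/
lemma probEvent_dataErr_gt_le [Nonempty A] {g g' : S → A → ℝ} (hg : g ∈ stepClass S A H)
    (hg' : g' ∈ stepClass S A H) (h : Fin H) (t : Fin Non) (x : ℝ) :
    probEvent M πoff L {ω | 2 * dataExcess M ω t h g g' + 64 * (H : ℝ) ^ 2 * x <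
      dataErr M πoff L ω t h (clipErr M h g g')} ≤ Real.exp (-x) := by
  have hH : (1 : ℝ) ≤ H := by exact_mod_cast h.pos
  set l : ℝ := (32 * (H : ℝ) ^ 2)⁻¹ with hl
  have hl0 : 0 < l := by positivity
  have hlH : l * (32 * (H : ℝ) ^ 2) = 1 := inv_mul_cancel₀ (by positivity)
  set e : Policy S A H → Traj S A H → ℝ := fun π τ => Real.exp (l *
    (expect (occ M π h) (fun s a => clipErr M h g g' s a ^ 2) / 2 - excess M h g g' τ)) with he
  have key := sum_runProb_mul_prod_le_one (Non := Non) M πoff L (e πoff)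
    -- Only the episodes before `t` enter the data, so later episodes get the factor 1.
    (fun i off on τ => if i < (t : ℕ) then e (L i off on) τ else 1) (fun τ => (Real.exp_pos _).le)
    (fun i off on τ => by
      split_ifs
      · exact (Real.exp_pos _).le
      · exact zero_le_one)
    (trajExp_exp_le_one M πoff hg hg' h)
    (fun i off on => by
      by_cases hi : i < (t : ℕ)
      · simp only [if_pos hi]
        exact trajExp_exp_le_one M _ hg hg' h
      · simp only [if_neg hi]
        exact (trajExp_const M _ 1).le)
  have hprod : ∀ ω : (Fin Noff → Traj S A H) × (Fin Non → Traj S A H),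
      (∏ i, e πoff (ω.1 i)) * (∏ i : Fin Non, if (i : ℕ) < (t : ℕ) then
        e (L i ω.1 (history ω.2 i)) (ω.2 i) else 1) =
      Real.exp (l * (dataErr M πoff L ω t h (clipErr M h g g') / 2 - dataExcess M ω t h g g')) := by
    intro ω
    have h1 : (∏ i : Fin Non, if (i : ℕ) < (t : ℕ) then
        e (L i ω.1 (history ω.2 i)) (ω.2 i) else 1) =
        ∏ i ∈ Finset.Iio t, e (playedPolicy L ω i) (ω.2 i) := by
      rw [← Finset.prod_filter]
      refine Finset.prod_congr ?_ fun i _ => rfl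
      ext i
      simp
    rw [h1, dataExcess_eq]
    simp only [he]
    rw [← Real.exp_sum, ← Real.exp_sum, ← Real.exp_add]
    congr 1
    unfold dataErr
    simp only [← Finset.mul_sum, Finset.sum_sub_distrib, Finset.sum_const, Finset.card_univ,
      Fintype.card_fin, nsmul_eq_mul, ← Finset.sum_div]
    ring
  simp only [hprod] at key
  -- Markov's inequality: on the event the exponent exceeds `l * 32 H² x = x`.
  have hle : probEvent M πoff L {ω | 2 * dataExcess M ω t h g g' + 64 * (H : ℝ) ^ 2 * x <
      dataErr M πoff L ω t h (clipErr M h g g')} ≤ ∑ ω, Real.exp (-x) * (runProb M πoff L ω *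
        Real.exp (l * (dataErr M πoff L ω t h (clipErr M h g g') / 2 -
          dataExcess M ω t h g g'))) := by
    refine Finset.sum_le_sum fun ω _ => ?_
    by_cases hω : 2 * dataExcess M ω t h g g' + 64 * (H : ℝ) ^ 2 * x <
      dataErr M πoff L ω t h (clipErr M h g g')
    · rw [Set.indicator_of_mem (by exact hω), mul_left_comm, ← Real.exp_add]
      refine le_mul_of_one_le_right (runProb_nonneg M πoff L ω) (Real.one_le_exp ?_)
      have h1 := mul_le_mul_of_nonneg_left hω.le hl0.le
      have h2 : l * (64 * (H : ℝ) ^ 2 * x) = 2 * x := by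
        calc _ = 2 * (l * (32 * (H : ℝ) ^ 2)) * x := by ring
          _ = _ := by rw [hlH, mul_one]
      linarith
    · rw [Set.indicator_of_notMem (by exact hω)]
      exact mul_nonneg (Real.exp_pos _).le
        (mul_nonneg (runProb_nonneg M πoff L ω) (Real.exp_pos _).le)
  rw [← Finset.mul_sum] at hle
  exact hle.trans (mul_le_of_le_one_right (Real.exp_pos _).le key)

end Run

section Optimality

variable {S A : Type*} [Fintype S] [Fintype A] {H : ℕ} (M : MDP S A H)

/-! ### The optimal action values -/

/-- The optimal action values with `k` steps to go. -/
def optQAux : ℕ → S → A → ℝ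
  | 0 => fun _ _ => 0
  -- With `k + 1` steps to go the current step is `H - 1 - k`. The value 0 for `k ≥ H` is a filler
  -- that `optQ` never reaches.
  | k + 1 => if hk : k < H then bellman M ⟨H - 1 - k, by omega⟩ (optQAux k) else fun _ _ => 0

/-- The optimal action values. -/
def optQ : QFun S A H := fun h => optQAux M (H - h)

lemma nextQ_optQ (h : Fin H) : nextQ (optQ M) h = optQAux M (H - h - 1) := by
  unfold nextQ optQ
  split_ifs with hh
  · rw [Nat.sub_sub]
  · rw [show H - (h : ℕ) - 1 = 0 by omega, optQAux]

lemma optQ_eq_bellman (h : Fin H) : optQ M h = bellman M h (nextQ (optQ M) h) := by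
  rw [nextQ_optQ]
  obtain ⟨k, hk⟩ : ∃ k, H - (h : ℕ) = k + 1 := ⟨H - h - 1, by omega⟩
  unfold optQ
  rw [hk, Nat.add_sub_cancel, optQAux, dif_pos (by omega)]
  congr
  omega

lemma optQAux_mem [Nonempty A] (k : ℕ) (s : S) (a : A) :
    optQAux M k s a ∈ Set.Icc (0 : ℝ) k := by
  induction k generalizing s a with
  | zero => simp [optQAux]
  | succ k ih =>
    rw [optQAux]
    split_ifs with hk
    · have hR := M.R_mem ⟨H - 1 - k, by omega⟩ s a
      have h1 : 0 ≤ ∑ s', M.P ⟨H - 1 - k, by omega⟩ s a s' * ⨆ a', optQAux M k s' a' :=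
        Finset.sum_nonneg fun s' _ => mul_nonneg (kernel_nonneg M _ s a s')
          (Real.iSup_nonneg fun a' => (ih s' a').1)
      have h2 : ∑ s', M.P ⟨H - 1 - k, by omega⟩ s a s' * ⨆ a', optQAux M k s' a' ≤ k := by
        refine (Finset.sum_le_sum fun s' _ => mul_le_mul_of_nonneg_left
          (ciSup_le fun a' => (ih s' a').2) (kernel_nonneg M _ s a s')).trans ?_
        rw [← Finset.sum_mul, kernel_sum, one_mul]
      push_cast
      exact ⟨by unfold bellman; linarith [hR.1], by unfold bellman; linarith [hR.2]⟩
    · exact ⟨le_rfl, by positivity⟩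

lemma optQ_mem [Nonempty A] : optQ M ∈ qClass S A H := fun h s a => by
  have h1 := optQAux_mem M (H - h) s a
  have h2 : ((H - h : ℕ) : ℝ) ≤ H := by exact_mod_cast Nat.sub_le _ _
  exact ⟨h1.1, h1.2.trans h2⟩

/-- The optimal values never exceed `H`, so clipping leaves their backup unchanged. Their excess
loss is therefore measured against themselves, which is what keeps them in the confidence sets. -/
lemma clipBellman_optQ [Nonempty A] (h : Fin H) :
    clipBellman M h (nextQ (optQ M) h) = optQ M h := by
  funext s a
  unfold clipBellman
  rw [← optQ_eq_bellman]
  exact min_eq_left (optQ_mem M h s a).2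

/-! ### Decomposition of values along trajectories -/

/-- The sum telescopes along the states; the boundary term at step `H` is 0 because `nextQ` vanishes
after the last step. -/
lemma sum_iSup_sub_iSup_nextQ [Nonempty A] [NeZero H] (f : QFun S A H) (τ : Traj S A H) :
    ∑ h : Fin H, ((⨆ a, f h (τ.1 h.castSucc) a) - ⨆ a, nextQ f h (τ.1 h.succ) a) =
      ⨆ a, f 0 (τ.1 0) a := by
  set v : ℕ → ℝ := fun k => if hk : k < H then ⨆ a, f ⟨k, hk⟩ (τ.1 ⟨k, by omega⟩) a else 0 with hv
  have h1 : ∀ h : Fin H, ((⨆ a, f h (τ.1 h.castSucc) a) - ⨆ a, nextQ f h (τ.1 h.succ) a) =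
      v h - v (h + 1) := by
    intro h
    simp only [hv, dif_pos h.isLt, nextQ]
    congr 1
    split_ifs
    · rfl
    · simp
  rw [Finset.sum_congr rfl fun h _ => h1 h, Fin.sum_univ_eq_sum_range (fun k => v k - v (k + 1)),
    Finset.sum_range_sub']
  simp only [hv, lt_irrefl, dif_neg, not_false_eq_true, sub_zero, dif_pos (NeZero.pos H)]
  rfl

lemma trajExp_sum_sub_eq (π : Policy S A H) (f : QFun S A H) :
    trajExp M π (fun τ => ∑ h : Fin H, (f h (τ.1 h.castSucc) (τ.2 h) -
      ⨆ a, nextQ f h (τ.1 h.succ) a) - ∑ h : Fin H, M.R h (τ.1 h.castSucc) (τ.2 h)) =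
      ∑ h, expect (occ M π h) (bellmanErr M f h) := by
  simp only [← Finset.sum_sub_distrib]
  rw [trajExp_sum]
  refine Finset.sum_congr rfl fun h _ => ?_
  rw [trajExp_transition M π h fun s a s' =>
    f h s a - (⨆ a', nextQ f h s' a') - M.R h s a]
  congr 1
  funext s a
  simp only [mul_sub, Finset.sum_sub_distrib, ← Finset.sum_mul, kernel_sum, bellmanErr, bellman]
  ring

lemma le_iSup_apply (g : S → A → ℝ) (s : S) (a : A) : g s a ≤ ⨆ a', g s a' :=
  le_ciSup (Set.finite_range (g s)).bddAbove a

lemma trajProb_ne_zero {π : Policy S A H} {τ : Traj S A H} (h : trajProb M π τ ≠ 0) :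
    τ.1 0 = M.x₁ ∧ ∀ k : Fin H, π k (τ.1 k.castSucc) (τ.2 k) ≠ 0 := by
  classical
  unfold trajProb at h
  constructor
  · by_contra h0
    exact h (by rw [if_neg h0, zero_mul])
  · intro k hk
    exact h (mul_eq_zero_of_right _ (Finset.prod_eq_zero (Finset.mem_univ k) (by rw [hk, zero_mul])))

/-- `optQ` has zero Bellman error, so the value is the mean of the sum of `optQ` at the current pair
minus its maximum at the next state. Replacing the first term by its maximum over actions makes the
sum telescope. -/
lemma value_le_iSup_optQ [Nonempty A] [NeZero H] (π : Policy S A H) :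
    value M π ≤ ⨆ a, optQ M 0 M.x₁ a := by
  have h1 := trajExp_sum_sub_eq M π (optQ M)
  have h2 : ∑ h, expect (occ M π h) (bellmanErr M (optQ M) h) = 0 := by
    refine Finset.sum_eq_zero fun h _ => ?_
    refine Finset.sum_eq_zero fun s _ => Finset.sum_eq_zero fun a _ => ?_
    rw [bellmanErr, ← optQ_eq_bellman, sub_self, mul_zero]
  rw [h2, trajExp_sub, ← value_eq_trajExp, sub_eq_zero] at h1
  rw [← h1, ← trajExp_const M π (⨆ a, optQ M 0 M.x₁ a)]
  refine trajExp_mono M π fun τ hτ => ?_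
  rw [← (trajProb_ne_zero M hτ).1, ← sum_iSup_sub_iSup_nextQ]
  exact Finset.sum_le_sum fun h _ => sub_le_sub_right (le_iSup_apply _ _ _) _

lemma iSup_eq_of_isGreedy [Nonempty A] {gr : QFun S A H → Fin H → S → A} (hgr : IsGreedy gr)
    (f : QFun S A H) (h : Fin H) (s : S) : ⨆ a, f h s a = f h s (gr f h s) :=
  le_antisymm (ciSup_le fun a => hgr f h s a) (le_iSup_apply _ _ _)

/-- The gap between the predicted and the actual value of a greedy policy is the sum of its expected
Bellman errors. -/
lemma greedy_sub_value [Nonempty A] [NeZero H] {gr : QFun S A H → Fin H → S → A}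
    (hgr : IsGreedy gr) (f : QFun S A H) :
    f 0 M.x₁ (gr f 0 M.x₁) - value M (detPolicy (gr f)) =
      ∑ h, expect (occ M (detPolicy (gr f)) h) (bellmanErr M f h) := by
  rw [← trajExp_sum_sub_eq, trajExp_sub, ← value_eq_trajExp, ← iSup_eq_of_isGreedy hgr f]
  congr 1
  rw [← trajExp_const M (detPolicy (gr f)) (⨆ a, f 0 M.x₁ a)]
  refine Finset.sum_congr rfl fun τ _ => ?_
  -- On trajectories of positive probability the action is the greedy one, so the maxima in the
  -- telescoping sum are attained and equality holds.
  by_cases hτ : trajProb M (detPolicy (gr f)) τ = 0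
  · rw [hτ, zero_mul, zero_mul]
  obtain ⟨h0, h1⟩ := trajProb_ne_zero M hτ
  congr 1
  rw [← h0, ← sum_iSup_sub_iSup_nextQ]
  refine Finset.sum_congr rfl fun h _ => ?_
  have : τ.2 h = gr f h (τ.1 h.castSucc) := by
    by_contra hne
    exact h1 h (by classical exact Pi.single_eq_of_ne hne 1)
  rw [this, iSup_eq_of_isGreedy hgr]

lemma value_nonneg (π : Policy S A H) : 0 ≤ value M π :=
  Finset.sum_nonneg fun τ _ => mul_nonneg (trajProb_nonneg M π τ)
    (Finset.sum_nonneg fun h _ => (M.R_mem h _ _).1)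

lemma optValue_le_iSup_optQ [Nonempty A] [NeZero H] : optValue M ≤ ⨆ a, optQ M 0 M.x₁ a := by
  classical
  obtain ⟨a₀⟩ := ‹Nonempty A›
  have : Nonempty (Policy S A H) := ⟨detPolicy fun _ _ => a₀⟩
  have : Nonempty A := ⟨a₀⟩
  exact ciSup_le fun π => value_le_iSup_optQ M π

lemma optValue_le [Nonempty A] [NeZero H] : optValue M ≤ H :=
  (optValue_le_iSup_optQ M).trans (ciSup_le fun a => (optQ_mem M 0 M.x₁ a).2)

end Optimality

/-! ### Covering the tabular class -/

section Cover

variable (S A : Type*) [Fintype S] [Fintype A] (H : ℕ)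

lemma edist_le_one_div_iff {N : ℕ} (f f' : QFun S A H) :
    edist f f' ≤ ((1 / (N : ℝ≥0) : ℝ≥0) : ℝ≥0∞) ↔ ∀ h s a, |f h s a - f' h s a| ≤ 1 / (N : ℝ) := by
  simp only [edist_pi_le_iff]
  refine forall_congr' fun h => forall_congr' fun s => forall_congr' fun a => ?_
  rw [edist_le_coe, ← NNReal.coe_le_coe, coe_nndist, Real.dist_eq]
  push_cast
  rfl

/-- Rounding down to multiples of `1/N` leaves `H N + 1` possible values for each of the `H S A`
coordinates. -/
lemma coveringNumber_qClass_le {N : ℕ} (hN : 1 ≤ N) :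
    Metric.coveringNumber (1 / (N : ℝ≥0)) (qClass S A H) ≤
      ((H * N + 1) ^ (H * Fintype.card S * Fintype.card A) : ℕ) := by
  classical
  have hN0 : (0 : ℝ) < N := by exact_mod_cast hN
  set G : (Fin H → S → A → Fin (H * N + 1)) → QFun S A H := fun k h s a => (k h s a : ℝ) / N with hG
  have hsub : (↑(Finset.univ.image G) : Set (QFun S A H)) ⊆ qClass S A H := by
    intro f hf
    obtain ⟨k, -, rfl⟩ := Finset.mem_image.1 (Finset.mem_coe.1 hf)
    intro h s a
    refine ⟨by simp only [hG]; positivity, ?_⟩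
    rw [hG, div_le_iff₀ hN0]
    exact_mod_cast Nat.lt_succ_iff.1 (k h s a).isLt
  have hcov : Metric.IsCover (1 / (N : ℝ≥0)) (qClass S A H)
      (↑(Finset.univ.image G) : Set (QFun S A H)) := by
    intro f hf
    have hlt : ∀ h s a, ⌊f h s a * N⌋₊ < H * N + 1 := fun h s a => by
      refine Nat.lt_succ_iff.2 (Nat.floor_le_of_le ?_)
      push_cast
      exact mul_le_mul_of_nonneg_right (hf h s a).2 hN0.le
    refine ⟨G fun h s a => ⟨⌊f h s a * N⌋₊, hlt h s a⟩,
      Finset.mem_coe.2 (Finset.mem_image_of_mem _ (Finset.mem_univ _)), ?_⟩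
    refine (edist_le_one_div_iff S A H _ _).2 fun h s a => ?_
    have h1 := Nat.floor_le (mul_nonneg (hf h s a).1 hN0.le)
    have h2 := Nat.lt_floor_add_one (f h s a * N)
    have h3 : f h s a - (⌊f h s a * N⌋₊ : ℝ) / N = (f h s a * N - ⌊f h s a * N⌋₊) / N := by
      field_simp
    simp only [hG]
    rw [h3, abs_of_nonneg (div_nonneg (by linarith) hN0.le)]
    exact div_le_div_of_nonneg_right (by linarith) hN0.le
  refine (hcov.coveringNumber_le_encard hsub).trans ?_
  rw [Set.encard_coe_eq_coe_finsetCard]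
  refine Nat.cast_le.2 (Finset.card_image_le.trans (le_of_eq ?_))
  simp only [Finset.card_univ, Fintype.card_fun, Fintype.card_fin, ← pow_mul]
  congr 1
  ring

lemma exists_finset_cover {N : ℕ} (hN : 1 ≤ N) :
    ∃ C : Finset (QFun S A H), (∀ f ∈ C, f ∈ qClass S A H) ∧
      (∀ f ∈ qClass S A H, ∃ f' ∈ C, ∀ h s a, |f h s a - f' h s a| ≤ 1 / (N : ℝ)) ∧
      C.card = (Metric.coveringNumber (1 / (N : ℝ≥0)) (qClass S A H)).toNat := by
  have hfin : Metric.coveringNumber (1 / (N : ℝ≥0)) (qClass S A H) ≠ ⊤ :=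
    ne_top_of_le_ne_top (ENat.natCast_ne_top _) (coveringNumber_qClass_le S A H hN)
  obtain ⟨C, hC, hCfin, hcov, hcard⟩ := Metric.exists_set_encard_eq_coveringNumber hfin
  refine ⟨hCfin.toFinset, fun f hf => hC (hCfin.mem_toFinset.1 hf), fun f hf => ?_, ?_⟩
  · obtain ⟨f', hf', hd⟩ := hcov hf
    exact ⟨f', hCfin.mem_toFinset.2 hf', (edist_le_one_div_iff S A H f f').1 hd⟩
  · rw [← hcard, hCfin.encard_eq_coe_toFinset_card, ENat.toNat_natCast]

lemma one_le_coveringNumber_toNat {N : ℕ} (hN : 1 ≤ N) :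
    1 ≤ (Metric.coveringNumber (1 / (N : ℝ≥0)) (qClass S A H)).toNat := by
  obtain ⟨C, -, h2, h3⟩ := exists_finset_cover S A H hN
  obtain ⟨f, hf, -⟩ := h2 (fun _ _ _ => 0) fun h s a => ⟨le_rfl, Nat.cast_nonneg _⟩
  rw [← h3]
  exact Finset.card_pos.2 ⟨f, hf⟩

end Cover

/-! ### Stability of losses and errors -/

section Stability

variable {S A : Type*} [Fintype S] [Fintype A] [Nonempty A] {H : ℕ} (M : MDP S A H)
  {ρ : ℝ} {g₁ g₂ g₁' g₂' : S → A → ℝ}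

lemma abs_iSup_sub_le (h : ∀ s a, |g₁ s a - g₂ s a| ≤ ρ) (s : S) :
    |(⨆ a, g₁ s a) - ⨆ a, g₂ s a| ≤ ρ := by
  rw [abs_sub_le_iff]
  constructor
  · rw [sub_le_iff_le_add]
    refine ciSup_le fun a => ?_
    linarith [(abs_sub_le_iff.1 (h s a)).1, le_iSup_apply g₂ s a]
  · rw [sub_le_iff_le_add]
    refine ciSup_le fun a => ?_
    linarith [(abs_sub_le_iff.1 (h s a)).2, le_iSup_apply g₁ s a]

/-- Taking the maximum over actions, averaging over the kernel and truncating at `H` are all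
nonexpansive in the sup norm. -/
lemma abs_clipBellman_sub_le (h : Fin H) (hg : ∀ s a, |g₁ s a - g₂ s a| ≤ ρ) (s : S) (a : A) :
    |clipBellman M h g₁ s a - clipBellman M h g₂ s a| ≤ ρ := by
  unfold clipBellman
  refine (abs_min_sub_min_le_max _ _ _ _).trans ?_
  rw [sub_self, abs_zero, max_eq_left (abs_nonneg _)]
  unfold bellman
  rw [add_sub_add_left_eq_sub, ← Finset.sum_sub_distrib]
  refine (Finset.abs_sum_le_sum_abs _ _).trans ?_
  calc _ ≤ ∑ s', M.P h s a s' * ρ := by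
        refine Finset.sum_le_sum fun s' _ => ?_
        rw [← mul_sub, abs_mul, abs_of_nonneg (kernel_nonneg M h s a s')]
        exact mul_le_mul_of_nonneg_left (abs_iSup_sub_le hg s') (kernel_nonneg M h s a s')
    _ = ρ := by rw [← Finset.sum_mul, kernel_sum, one_mul]

lemma abs_clipErr_sub_le (h : Fin H) (hg : ∀ s a, |g₁ s a - g₂ s a| ≤ ρ)
    (hg' : ∀ s a, |g₁' s a - g₂' s a| ≤ ρ) (s : S) (a : A) :
    |clipErr M h g₁ g₁' s a - clipErr M h g₂ g₂' s a| ≤ 2 * ρ := by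
  have h1 := abs_le.1 (hg s a)
  have h2 := abs_le.1 (abs_clipBellman_sub_le M h hg' s a)
  unfold clipErr
  rw [abs_le]
  constructor <;> linarith

lemma abs_stepLoss_sub_le (h : Fin H) (h₁ : g₁ ∈ stepClass S A H) (h₂ : g₂ ∈ stepClass S A H)
    (h₁' : g₁' ∈ stepClass S A H) (h₂' : g₂' ∈ stepClass S A H)
    (hg : ∀ s a, |g₁ s a - g₂ s a| ≤ ρ) (hg' : ∀ s a, |g₁' s a - g₂' s a| ≤ ρ) (τ : Traj S A H) :
    |stepLoss M h g₁ g₁' τ - stepLoss M h g₂ g₂' τ| ≤ 8 * H * ρ := by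
  unfold stepLoss
  set s := τ.1 h.castSucc
  set a := τ.2 h
  set s' := τ.1 h.succ
  have e1 := abs_le.1 (hg s a)
  have e2 := abs_le.1 (abs_iSup_sub_le hg' s')
  have t1 := target_mem M h₁' h s a s'
  have t2 := target_mem M h₂' h s a s'
  have u1 := h₁ s a
  have u2 := h₂ s a
  rw [sq_sub_sq, abs_mul]
  calc _ ≤ (4 * H) * (2 * ρ) := by
        refine mul_le_mul (abs_le.2 ⟨?_, ?_⟩) (abs_le.2 ⟨?_, ?_⟩) (abs_nonneg _) (by positivity)
        · linarith [t1.2, t2.2, u1.1, u2.1]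
        · linarith [t1.1, t2.1, u1.2, u2.2]
        · linarith
        · linarith
    _ = _ := by ring

lemma abs_excess_sub_le (h : Fin H) (h₁ : g₁ ∈ stepClass S A H) (h₂ : g₂ ∈ stepClass S A H)
    (h₁' : g₁' ∈ stepClass S A H) (h₂' : g₂' ∈ stepClass S A H)
    (hg : ∀ s a, |g₁ s a - g₂ s a| ≤ ρ) (hg' : ∀ s a, |g₁' s a - g₂' s a| ≤ ρ) (τ : Traj S A H) :
    |excess M h g₁ g₁' τ - excess M h g₂ g₂' τ| ≤ 16 * H * ρ := by
  have e1 := abs_le.1 (abs_stepLoss_sub_le M h h₁ h₂ h₁' h₂' hg hg' τ)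
  have e2 := abs_le.1 (abs_stepLoss_sub_le M h (clipBellman_mem M h₁' h) (clipBellman_mem M h₂' h)
    h₁' h₂' (abs_clipBellman_sub_le M h hg') hg' τ)
  unfold excess
  rw [abs_le]
  constructor <;> linarith

variable {Noff Non : ℕ} (ω : (Fin Noff → Traj S A H) × (Fin Non → Traj S A H)) (t : Fin Non)

lemma card_Iio_le : ((Finset.Iio t).card : ℝ) ≤ Non := by
  rw [Fin.card_Iio]
  exact_mod_cast t.isLt.le

lemma dataExcess_le_add (h : Fin H) (hρ : 0 ≤ ρ) (h₁ : g₁ ∈ stepClass S A H)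
    (h₂ : g₂ ∈ stepClass S A H)
    (h₁' : g₁' ∈ stepClass S A H) (h₂' : g₂' ∈ stepClass S A H)
    (hg : ∀ s a, |g₁ s a - g₂ s a| ≤ ρ) (hg' : ∀ s a, |g₁' s a - g₂' s a| ≤ ρ) :
    dataExcess M ω t h g₂ g₂' ≤
      dataExcess M ω t h g₁ g₁' + (Noff + Non : ℕ) * (16 * H * ρ) := by
  have hτ : ∀ τ, excess M h g₂ g₂' τ ≤ excess M h g₁ g₁' τ + 16 * H * ρ := fun τ => by
    linarith [(abs_le.1 (abs_excess_sub_le M h h₁ h₂ h₁' h₂' hg hg' τ)).1]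
  rw [dataExcess_eq, dataExcess_eq]
  have e1 := Finset.sum_le_sum fun i (_ : i ∈ Finset.univ) => hτ (ω.1 i)
  have e2 := Finset.sum_le_sum fun i (_ : i ∈ Finset.Iio t) => hτ (ω.2 i)
  rw [Finset.sum_add_distrib, Finset.sum_const, nsmul_eq_mul] at e1 e2
  rw [Finset.card_univ, Fintype.card_fin] at e1
  have e3 := mul_le_mul_of_nonneg_right (card_Iio_le t) (by positivity : 0 ≤ 16 * H * ρ)
  push_cast
  linarith

lemma expect_sq_le (π : Policy S A H) (h : Fin H) {u v : S → A → ℝ} {r : ℝ}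
    (huv : ∀ s a, |u s a - v s a| ≤ r) :
    expect (occ M π h) (fun s a => u s a ^ 2) ≤
      2 * expect (occ M π h) (fun s a => v s a ^ 2) + 2 * r ^ 2 := by
  rw [← expect_const_mul, ← expect_occ_const M π h (2 * r ^ 2), ← expect_add]
  refine expect_mono (occ_nonneg M π h) fun s a => ?_
  have h1 : (u s a - v s a) ^ 2 ≤ r ^ 2 := sq_le_sq' (abs_le.1 (huv s a)).1 (abs_le.1 (huv s a)).2
  nlinarith [sq_nonneg (u s a - 2 * v s a)]

lemma dataErr_le (πoff : Policy S A H) (L : Learner S A H Noff) (h : Fin H) {u v : S → A → ℝ}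
    {r : ℝ} (huv : ∀ s a, |u s a - v s a| ≤ r) :
    dataErr M πoff L ω t h u ≤
      2 * dataErr M πoff L ω t h v + (Noff + Non : ℕ) * (2 * r ^ 2) := by
  unfold dataErr
  have e1 := mul_le_mul_of_nonneg_left (expect_sq_le M πoff h huv) (Nat.cast_nonneg (α := ℝ) Noff)
  have e2 := Finset.sum_le_sum fun i (_ : i ∈ Finset.Iio t) =>
    expect_sq_le M (playedPolicy L ω i) h huv
  rw [Finset.sum_add_distrib, Finset.sum_const, nsmul_eq_mul, ← Finset.mul_sum] at e2
  have e3 := mul_le_mul_of_nonneg_right (card_Iio_le t) (by positivity : 0 ≤ 2 * r ^ 2)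
  push_cast
  linarith

end Stability

/-! ### Confidence sets -/

section Confidence

variable {S A : Type*} [Fintype S] [Fintype A] {H : ℕ}

lemma log_two_le_logCover (S A : Type*) [Fintype S] [Fintype A] {H N : ℕ} (hH : 1 ≤ H)
    (hN : 2 ≤ N) {δ : ℝ} (hδ : 0 < δ) (hδ1 : δ < 1) : Real.log 2 ≤ logCover S A H N δ := by
  unfold logCover
  refine Real.log_le_log two_pos ?_
  have h1 : (1 : ℝ) ≤ H := by exact_mod_cast hH
  have h2 : (2 : ℝ) ≤ N := by exact_mod_cast hN
  have h3 : (1 : ℝ) ≤ (Metric.coveringNumber (1 / (N : ℝ≥0)) (qClass S A H)).toNat := by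
    exact_mod_cast one_le_coveringNumber_toNat S A H (by omega : 1 ≤ N)
  rw [le_div_iff₀ hδ]
  calc 2 * δ ≤ 2 * 1 * 1 := by linarith
    _ ≤ _ := by gcongr

/-- For `H ≤ N` and `N ≥ 2` one has `H N + 1 ≤ N³`, so the covering number is at most `N^(3k)` with
`k = H S A`. The three logarithms then add up to at most `(1 + 1 + 3k) log(N/δ) ≤ 5k log(N/δ)`. -/
lemma logCover_le (S A : Type*) [Fintype S] [Fintype A] [Nonempty S] [Nonempty A] {H N : ℕ}
    (hH : 1 ≤ H) (hN : 2 ≤ N) (hHN : H ≤ N) {δ : ℝ} (hδ : 0 < δ) (hδ1 : δ < 1) :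
    logCover S A H N δ ≤ 5 * ((H : ℝ) * Fintype.card S * Fintype.card A * Real.log (N / δ)) := by
  unfold logCover
  set n := (Metric.coveringNumber (1 / (N : ℝ≥0)) (qClass S A H)).toNat with hn
  set k := H * Fintype.card S * Fintype.card A with hk
  have hk1 : 1 ≤ k := Nat.mul_pos (Nat.mul_pos hH Fintype.card_pos) Fintype.card_pos
  have hn1 : 1 ≤ n := one_le_coveringNumber_toNat S A H (by omega : 1 ≤ N)
  have hn2 : n ≤ (H * N + 1) ^ k :=
    ENat.toNat_le_of_le_natCast (coveringNumber_qClass_le S A H (by omega : 1 ≤ N))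
  have hn3 : n ≤ N ^ (3 * k) := by
    rw [pow_mul]
    refine hn2.trans (Nat.pow_le_pow_left ?_ k)
    have e1 : H * N ≤ N * N := Nat.mul_le_mul_right N hHN
    have e2 : N * N * 2 ≤ N * N * N := Nat.mul_le_mul_left _ hN
    have e3 : 1 ≤ N * N := Nat.mul_pos (by omega) (by omega)
    have e4 : N ^ 3 = N * N * N := by ring
    omega
  have hH' : (1 : ℝ) ≤ H := by exact_mod_cast hH
  have hN' : (2 : ℝ) ≤ N := by exact_mod_cast hN
  have hHN' : (H : ℝ) ≤ N := by exact_mod_cast hHN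
  have hn' : (1 : ℝ) ≤ n := by exact_mod_cast hn1
  have hn3' : (n : ℝ) ≤ (N : ℝ) ^ (3 * k) := by exact_mod_cast hn3
  have hk' : (1 : ℝ) ≤ k := by exact_mod_cast hk1
  have hNδ : (N : ℝ) ≤ N / δ := by
    rw [le_div_iff₀ hδ]
    nlinarith
  have e : (N : ℝ) * H * n / δ = N / δ * H * n := by ring
  rw [e, Real.log_mul (by positivity) (by positivity), Real.log_mul (by positivity) (by positivity)]
  have l0 : 0 ≤ Real.log (N / δ) := Real.log_nonneg (by linarith)
  have l1 : Real.log H ≤ Real.log (N / δ) := Real.log_le_log (by linarith) (by linarith)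
  have l2 : Real.log n ≤ 3 * k * Real.log (N / δ) := by
    calc Real.log n ≤ Real.log ((N : ℝ) ^ (3 * k)) := Real.log_le_log (by linarith) hn3'
      _ = 3 * k * Real.log N := by rw [Real.log_pow]; push_cast; ring
      _ ≤ _ := by gcongr
  have hkr : (H : ℝ) * Fintype.card S * Fintype.card A = k := by rw [hk]; push_cast; ring
  rw [hkr]
  nlinarith

variable [Nonempty A] (M : MDP S A H) (πoff : Policy S A H) {Noff Non : ℕ}
  (L : Learner S A H Noff)

lemma nextQ_sub_le {f f' : QFun S A H} {ρ : ℝ} (hρ : 0 ≤ ρ)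
    (hf : ∀ h s a, |f h s a - f' h s a| ≤ ρ) (h : Fin H) (s : S) (a : A) :
    |nextQ f h s a - nextQ f' h s a| ≤ ρ := by
  unfold nextQ
  split_ifs
  · exact hf _ s a
  · simpa using hρ

/-- The outcomes for which the empirical losses are accurate, uniformly over the tabular class. -/
def accurateEvent (x : ℝ) : Set ((Fin Noff → Traj S A H) × (Fin Non → Traj S A H)) :=
  {ω | ∀ t h,
    (∀ f ∈ qClass S A H, dataErr M πoff L ω t h (clipErr M h (f h) (nextQ f h)) ≤
      4 * dataExcess M ω t h (f h) (nextQ f h) + 361 * ((H : ℝ) ^ 2 * x)) ∧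
    ∀ g ∈ stepClass S A H, -(88 * ((H : ℝ) ^ 2 * x)) ≤ dataExcess M ω t h g (nextQ (optQ M) h)}

/-- Two regression targets are needed for each `f` of the cover. Its own next function controls the
error of `f`; the optimal values make an arbitrary competitor comparable with `optQ`. This is the
factor 2 in the union bound. -/
lemma one_sub_le_probEvent_finset (C : Finset (QFun S A H)) (hC : ∀ f ∈ C, f ∈ qClass S A H)
    (x : ℝ) :
    1 - Non * H * C.card * 2 * Real.exp (-x) ≤ probEvent (Non := Non) M πoff L
      {ω | ∀ t h, ∀ f ∈ C,
        dataErr M πoff L ω t h (clipErr M h (f h) (nextQ f h)) ≤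
          2 * dataExcess M ω t h (f h) (nextQ f h) + 64 * (H : ℝ) ^ 2 * x ∧
        dataErr M πoff L ω t h (clipErr M h (f h) (nextQ (optQ M) h)) ≤
          2 * dataExcess M ω t h (f h) (nextQ (optQ M) h) + 64 * (H : ℝ) ^ 2 * x} := by
  rw [probEvent_compl]
  refine sub_le_sub_left ?_ 1
  let target : QFun S A H → Fin H → Bool → S → A → ℝ := fun f h b =>
    nextQ (if b then f else optQ M) h
  let bad : Fin Non × Fin H × QFun S A H × Bool →
      Set ((Fin Noff → Traj S A H) × (Fin Non → Traj S A H)) := fun i =>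
    {ω | 2 * dataExcess M ω i.1 i.2.1 (i.2.2.1 i.2.1) (target i.2.2.1 i.2.1 i.2.2.2) +
      64 * (H : ℝ) ^ 2 * x < dataErr M πoff L ω i.1 i.2.1
        (clipErr M i.2.1 (i.2.2.1 i.2.1) (target i.2.2.1 i.2.1 i.2.2.2))}
  let I : Finset (Fin Non × Fin H × QFun S A H × Bool) :=
    Finset.univ ×ˢ Finset.univ ×ˢ C ×ˢ Finset.univ
  have hsub : {ω | ∀ t h, ∀ f ∈ C,
        dataErr M πoff L ω t h (clipErr M h (f h) (nextQ f h)) ≤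
          2 * dataExcess M ω t h (f h) (nextQ f h) + 64 * (H : ℝ) ^ 2 * x ∧
        dataErr M πoff L ω t h (clipErr M h (f h) (nextQ (optQ M) h)) ≤
          2 * dataExcess M ω t h (f h) (nextQ (optQ M) h) + 64 * (H : ℝ) ^ 2 * x}ᶜ ⊆
      ⋃ i ∈ I, bad i := by
    intro ω hω
    simp only [Set.mem_compl_iff, Set.mem_ofPred_eq, not_forall] at hω
    obtain ⟨t, h, f, hf, hnot⟩ := hω
    rw [not_and_or, not_le, not_le] at hnot
    rcases hnot with hnot | hnot
    · exact Set.mem_iUnion₂.2 ⟨(t, h, f, true), by simp [I, hf], by simpa [bad, target] using hnot⟩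
    · exact Set.mem_iUnion₂.2 ⟨(t, h, f, false), by simp [I, hf], by simpa [bad, target] using hnot⟩
  refine (probEvent_mono M πoff L hsub).trans ((probEvent_biUnion_le M πoff L I bad).trans ?_)
  have hle : ∀ i ∈ I, probEvent M πoff L (bad i) ≤ Real.exp (-x) := fun i hi => by
    simp only [I, Finset.mem_product, Finset.mem_univ, true_and, and_true] at hi
    refine probEvent_dataErr_gt_le M πoff L (hC _ hi i.2.1) (nextQ_mem ?_ _) i.2.1 i.1 x
    split_ifs
    · exact hC _ hi
    · exact optQ_mem M
  refine (Finset.sum_le_sum hle).trans (le_of_eq ?_)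
  rw [Finset.sum_const, nsmul_eq_mul]
  simp only [I, Finset.card_product, Finset.card_univ, Fintype.card_fin, Fintype.card_bool]
  push_cast
  ring

lemma one_sub_le_probEvent_accurateEvent (hH : 1 ≤ H) (hoff : 1 ≤ Noff) (hon : 1 ≤ Non) {δ : ℝ}
    (hδ : 0 < δ) (hδ1 : δ < 1) :
    1 - δ ≤ probEvent (Non := Non) M πoff L
      (accurateEvent M πoff L (logCover S A H (Noff + Non) δ)) := by
  set N := Noff + Non with hN
  have hlog2 := log_two_le_logCover S A hH (by omega : 2 ≤ N) hδ hδ1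
  obtain ⟨C, hC, hcov, hcard⟩ := exists_finset_cover S A H (by omega : 1 ≤ N)
  set x := logCover S A H N δ with hx
  have hn1 : (1 : ℝ) ≤ C.card := by
    rw [hcard]
    exact_mod_cast one_le_coveringNumber_toNat S A H (by omega : 1 ≤ N)
  have hH' : (1 : ℝ) ≤ H := by exact_mod_cast hH
  have hN' : (2 : ℝ) ≤ N := by exact_mod_cast (by omega : 2 ≤ N)
  have hNon : (Non : ℝ) ≤ N := by exact_mod_cast (by omega : Non ≤ N)
  -- The summand `log 2` pays for the two targets.
  have hexp : Real.exp (-(Real.log 2 + x)) = δ / (2 * (N * H * C.card)) := by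
    have : Real.log 2 + x = Real.log (2 * (N * H * C.card) / δ) := by
      rw [hx, logCover, ← hcard, ← Real.log_mul (by norm_num) (by positivity)]
      congr 1
      ring
    rw [this, Real.exp_neg, Real.exp_log (by positivity), inv_div]
  have hprob := one_sub_le_probEvent_finset (Non := Non) M πoff L C hC (Real.log 2 + x)
  have hle : Non * H * C.card * 2 * Real.exp (-(Real.log 2 + x)) ≤ δ := by
    rw [hexp, mul_div_assoc', div_le_iff₀ (by positivity)]
    have : (Non : ℝ) * H * C.card * 2 ≤ N * H * C.card * 2 := by gcongr
    nlinarith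
  refine (sub_le_sub_left hle 1).trans (hprob.trans (probEvent_mono M πoff L ?_))
  intro ω hω t h
  have hl2 := Real.log_two_gt_d9
  have hH2 : (H : ℝ) ≤ (H : ℝ) ^ 2 := by nlinarith
  have hHx : (H : ℝ) ^ 2 * Real.log 2 ≤ (H : ℝ) ^ 2 * x := by gcongr
  have hρ : (0 : ℝ) ≤ 1 / (N : ℝ) := by positivity
  have hNρ : (N : ℝ) * (16 * H * (1 / (N : ℝ))) = 16 * H := by
    field_simp
  constructor
  · intro f hf
    obtain ⟨f', hf', hd⟩ := hcov f hf
    have h1 := (hω t h f' hf').1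
    have h2 := dataErr_le M ω t πoff L h
      (abs_clipErr_sub_le M h (hd h) (nextQ_sub_le hρ hd h))
    have h3 := dataExcess_le_add M ω t h hρ (hf h) (hC f' hf' h) (nextQ_mem hf h)
      (nextQ_mem (hC f' hf') h) (hd h) (nextQ_sub_le hρ hd h)
    rw [← hN] at h2 h3
    rw [hNρ] at h3
    have h4 : (N : ℝ) * (2 * (2 * (1 / (N : ℝ))) ^ 2) ≤ 8 := by
      have : (N : ℝ) * (2 * (2 * (1 / (N : ℝ))) ^ 2) = 8 / N := by
        field_simp
        norm_num
      rw [this, div_le_iff₀ (by positivity)]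
      linarith
    -- Passing from `f'` to `f` gives `4 dataExcess + 128 H² (log 2 + x) + 64 H + 8`. By `log 2 ≤ x`
    -- and `H ≤ H²`, everything after the first term is below `361 H² x`.
    nlinarith
  · intro g hg
    -- The competitor is a single step function, so the cover is applied to the family constantly
    -- equal to `g`.
    obtain ⟨f', hf', hd⟩ := hcov (fun _ => g) fun _ => hg
    have h1 := (hω t h f' hf').2
    have h2 : 0 ≤ dataErr M πoff L ω t h (clipErr M h (f' h) (nextQ (optQ M) h)) :=
      add_nonneg (mul_nonneg (Nat.cast_nonneg _)
        (expect_nonneg (occ_nonneg M πoff h) fun s a => sq_nonneg _))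
        (Finset.sum_nonneg fun i _ => expect_nonneg (occ_nonneg M _ h) fun s a => sq_nonneg _)
    have h3 := dataExcess_le_add M ω t h hρ hg (hC f' hf' h) (nextQ_mem (optQ_mem M) h)
      (nextQ_mem (optQ_mem M) h) (hd h) (fun s a => by rw [sub_self, abs_zero]; exact hρ)
    rw [← hN, hNρ] at h3
    -- Nonnegativity of the error gives an excess of at least `-32 H² (log 2 + x) - 16 H`, which is
    -- at least `-88 H² x`.
    nlinarith

variable {M πoff L} {x : ℝ} {ω : (Fin Noff → Traj S A H) × (Fin Non → Traj S A H)}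

/-- No competitor beats the optimal values by more than `88 H² x`, and the width is `100 H² x`. -/
lemma optQ_mem_confSet (hx : 0 ≤ x) (hω : ω ∈ accurateEvent M πoff L x) (t : Fin Non) :
    optQ M ∈ confSet M ((H : ℝ) ^ 2 * (100 * x)) ω.1 (history ω.2 t) := by
  refine ⟨optQ_mem M, fun h g hg => ?_⟩
  have h1 := (hω t h).2 g hg
  rw [dataExcess, clipBellman_optQ] at h1
  nlinarith [mul_nonneg (sq_nonneg (H : ℝ)) hx]

/-- Membership, tested against the clipped backup, bounds the excess by the width, and `4 * 100 +
361 = 761`. -/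
lemma dataErr_le_of_mem_confSet (hω : ω ∈ accurateEvent M πoff L x) (t : Fin Non)
    {f : QFun S A H} (hf : f ∈ confSet M ((H : ℝ) ^ 2 * (100 * x)) ω.1 (history ω.2 t))
    (h : Fin H) :
    dataErr M πoff L ω t h (clipErr M h (f h) (nextQ f h)) ≤ 761 * ((H : ℝ) ^ 2 * x) := by
  have h1 := (hω t h).1 f hf.1
  have h2 := hf.2 h _ (clipBellman_mem M (nextQ_mem hf.1 h) h)
  rw [dataExcess] at h1
  linarith

end Confidence

/-! ### Regret -/

section Regret

variable {S A : Type*} [Fintype S] [Fintype A] {H : ℕ} (M : MDP S A H) (πoff : Policy S A H)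

/-- Jensen's inequality on the slice, of mass at most 1, followed by the change of measure `d^π ≤ r
μ`. -/
lemma sum_slice_off_le {Xoff : Set (S × A × Fin H)} (hr : ratioSup M πoff Xoff ≠ ⊤)
    (π : Policy S A H) (h : Fin H) (u : S → A → ℝ) :
    ∑ x ∈ sliceFinset Xoff h, occ M π h x.1 x.2 * |u x.1 x.2| ≤
      Real.sqrt ((ratioSup M πoff Xoff).toReal *
        expect (occ M πoff h) fun s a => u s a ^ 2) := by
  refine Real.le_sqrt_of_sq_le ?_
  set s := sliceFinset Xoff h
  have h1 : (∑ x ∈ s, occ M π h x.1 x.2 * |u x.1 x.2|) ^ 2 ≤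
      (∑ x ∈ s, occ M π h x.1 x.2) * ∑ x ∈ s, occ M π h x.1 x.2 * u x.1 x.2 ^ 2 := by
    refine Finset.sum_sq_le_sum_mul_sum_of_sq_le_mul _ (fun x _ => occ_nonneg M π h _ _)
      (fun x _ => mul_nonneg (occ_nonneg M π h _ _) (sq_nonneg _)) fun x _ => le_of_eq ?_
    rw [mul_pow, sq_abs]
    ring
  refine h1.trans ((mul_le_of_le_one_left (Finset.sum_nonneg fun x _ =>
    mul_nonneg (occ_nonneg M π h _ _) (sq_nonneg _)) (sum_occ_le_one M π h s)).trans ?_)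
  rw [expect_eq_sum_prod, Finset.mul_sum]
  refine (Finset.sum_le_sum fun x hx => ?_).trans
    (Finset.sum_le_sum_of_subset_of_nonneg (Finset.subset_univ s) fun x _ _ =>
      mul_nonneg ENNReal.toReal_nonneg (mul_nonneg (occ_nonneg M πoff h _ _) (sq_nonneg _)))
  rw [← mul_assoc]
  exact mul_le_mul_of_nonneg_right
    (occ_le_toReal_ratioSup_mul M πoff π Xoff (mem_sliceFinset.1 hx) hr) (sq_nonneg _)

/-- Cauchy–Schwarz over the episodes: each mean error is divided by its past squared error, floored
at `H²`. The ratios sum to the potential bound and each denominator is at most `W`. -/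
lemma sum_slice_on_le (Xon : Set (S × A × Fin H)) {T : ℕ} (π : Fin T → Policy S A H)
    (h : Fin H) (u : Fin T → S → A → ℝ) (hu : ∀ t s a, |u t s a| ≤ H) {W : ℝ}
    (hW : (H : ℝ) ^ 2 ≤ W)
    (hE : ∀ t, ∑ i ∈ Finset.Iio t, expect (occ M (π i) h) (fun s a => u t s a ^ 2) ≤ W) :
    ∑ t, ∑ x ∈ sliceFinset Xon h, occ M (π t) h x.1 x.2 * |u t x.1 x.2| ≤
      Real.sqrt (24 * (maxSlice Xon * Real.log (1 + T)) * (T * W)) := by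
  have hH : (0 : ℝ) < H := by exact_mod_cast h.pos
  set s := sliceFinset Xon h
  set B : Fin T → ℝ := fun t => max ((H : ℝ) ^ 2)
    (∑ i ∈ Finset.Iio t, ∑ x ∈ s, occ M (π i) h x.1 x.2 * |u t x.1 x.2| ^ 2)
  have hB0 : ∀ t, 0 < B t := fun t => lt_of_lt_of_le (by positivity) (le_max_left _ _)
  have hBW : ∀ t, B t ≤ W := fun t => by
    refine max_le hW (le_trans (Finset.sum_le_sum fun i _ => ?_) (hE t))
    simp only [sq_abs]
    rw [expect_eq_sum_prod]
    exact Finset.sum_le_sum_of_subset_of_nonneg (Finset.subset_univ s) fun x _ _ =>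
      mul_nonneg (occ_nonneg M _ h _ _) (sq_nonneg _)
  have key := sum_sq_div_max_le s hH (fun t x => occ M (π t) h x.1 x.2)
    (fun t x => |u t x.1 x.2|) (fun t x => occ_nonneg M (π t) h x.1 x.2)
    (fun t => sum_occ_le_one M (π t) h s) fun t x _ => by
      rw [abs_abs]
      linarith [hu t x.1 x.2]
  refine Real.le_sqrt_of_sq_le ?_
  have h1 : (∑ t, ∑ x ∈ s, occ M (π t) h x.1 x.2 * |u t x.1 x.2|) ^ 2 ≤
      (∑ t, (∑ x ∈ s, occ M (π t) h x.1 x.2 * |u t x.1 x.2|) ^ 2 / B t) * ∑ t, B t := by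
    refine Finset.sum_sq_le_sum_mul_sum_of_sq_le_mul _
      (fun t _ => div_nonneg (sq_nonneg _) (hB0 t).le) (fun t _ => (hB0 t).le) fun t _ => ?_
    rw [div_mul_cancel₀ _ (hB0 t).ne']
  have h2 : ∑ t, B t ≤ T * W := by
    refine (Finset.sum_le_sum fun t _ => hBW t).trans (le_of_eq ?_)
    rw [Finset.sum_const, nsmul_eq_mul, Finset.card_univ, Fintype.card_fin]
  have hlog : 0 ≤ Real.log (1 + T) := Real.log_nonneg (by linarith [Nat.cast_nonneg (α := ℝ) T])
  have hcard : (s.card : ℝ) ≤ maxSlice Xon := by exact_mod_cast card_sliceFinset_le Xon h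
  refine h1.trans (mul_le_mul (key.trans ?_) h2 (Finset.sum_nonneg fun t _ => (hB0 t).le)
    (by positivity))
  gcongr

lemma sum_expect_abs_le {Xoff Xon : Set (S × A × Fin H)} (hX : Xoff ∪ Xon = Set.univ)
    (hr : ratioSup M πoff Xoff ≠ ⊤) {T Noff : ℕ} (hoff : 1 ≤ Noff) (π : Fin T → Policy S A H)
    (u : Fin T → Fin H → S → A → ℝ) (hu : ∀ t h s a, |u t h s a| ≤ H) {W : ℝ}
    (hW : (H : ℝ) ^ 2 ≤ W)
    (hE : ∀ t h, Noff * expect (occ M πoff h) (fun s a => u t h s a ^ 2) +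
      ∑ i ∈ Finset.Iio t, expect (occ M (π i) h) (fun s a => u t h s a ^ 2) ≤ W) :
    ∑ t, ∑ h, expect (occ M (π t) h) (fun s a => |u t h s a|) ≤
      H * (T * Real.sqrt ((ratioSup M πoff Xoff).toReal * (W / Noff)) +
        Real.sqrt (24 * (maxSlice Xon * Real.log (1 + T)) * (T * W))) := by
  classical
  have hN : (0 : ℝ) < Noff := by exact_mod_cast hoff
  have hE1 : ∀ t h, 0 ≤ ∑ i ∈ Finset.Iio t, expect (occ M (π i) h) (fun s a => u t h s a ^ 2) :=
    fun t h => Finset.sum_nonneg fun i _ => expect_nonneg (occ_nonneg M _ h) fun s a => sq_nonneg _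
  rw [Finset.sum_comm]
  have hh : ∀ h ∈ (Finset.univ : Finset (Fin H)),
      ∑ t, expect (occ M (π t) h) (fun s a => |u t h s a|) ≤
      T * Real.sqrt ((ratioSup M πoff Xoff).toReal * (W / Noff)) +
        Real.sqrt (24 * (maxSlice Xon * Real.log (1 + T)) * (T * W)) := by
    intro h _
    have hsplit : ∀ t, expect (occ M (π t) h) (fun s a => |u t h s a|) ≤
        Real.sqrt ((ratioSup M πoff Xoff).toReal * (W / Noff)) +
        ∑ x ∈ sliceFinset Xon h, occ M (π t) h x.1 x.2 * |u t h x.1 x.2| := by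
      intro t
      have hnn : ∀ x : S × A, 0 ≤ occ M (π t) h x.1 x.2 * |u t h x.1 x.2| := fun x =>
        mul_nonneg (occ_nonneg M _ h _ _) (abs_nonneg _)
      have hun : (Finset.univ : Finset (S × A)) = sliceFinset Xoff h ∪ sliceFinset Xon h := by
        ext x
        have : (x.1, x.2, h) ∈ Xoff ∪ Xon := hX ▸ Set.mem_univ _
        simpa [mem_sliceFinset] using this
      rw [expect_eq_sum_prod, hun]
      -- The two sets may overlap; the intersection is counted twice, which is harmless for
      -- nonnegative terms.
      have h1 := Finset.sum_union_inter (s₁ := sliceFinset Xoff h) (s₂ := sliceFinset Xon h)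
        (f := fun x : S × A => occ M (π t) h x.1 x.2 * |u t h x.1 x.2|)
      have h2 : 0 ≤ ∑ x ∈ sliceFinset Xoff h ∩ sliceFinset Xon h,
        occ M (π t) h x.1 x.2 * |u t h x.1 x.2| := Finset.sum_nonneg fun x _ => hnn x
      have h3 := sum_slice_off_le M πoff hr (π t) h (u t h)
      have h4 : Real.sqrt ((ratioSup M πoff Xoff).toReal *
          expect (occ M πoff h) fun s a => u t h s a ^ 2) ≤
          Real.sqrt ((ratioSup M πoff Xoff).toReal * (W / Noff)) := by
        refine Real.sqrt_le_sqrt (mul_le_mul_of_nonneg_left ?_ ENNReal.toReal_nonneg)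
        rw [le_div_iff₀ hN]
        linarith [hE t h, hE1 t h]
      linarith
    refine (Finset.sum_le_sum fun t _ => hsplit t).trans ?_
    rw [Finset.sum_add_distrib, Finset.sum_const, nsmul_eq_mul, Finset.card_univ, Fintype.card_fin]
    refine add_le_add le_rfl (sum_slice_on_le M Xon π h (fun t => u t h) (fun t => hu t h) hW
      fun t => ?_)
    have : 0 ≤ (Noff : ℝ) * expect (occ M πoff h) (fun s a => u t h s a ^ 2) :=
      mul_nonneg hN.le (expect_nonneg (occ_nonneg M _ h) fun s a => sq_nonneg _)
    linarith [hE t h]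
  refine (Finset.sum_le_sum hh).trans (le_of_eq ?_)
  rw [Finset.sum_const, nsmul_eq_mul, Finset.card_univ, Fintype.card_fin]

variable {M πoff}

/-- The prefactor is strictly positive, which excludes the convention `0 * ∞ = 0`: an infinite ratio
makes the bound trivial. -/
lemma regretBound_eq_top [Nonempty S] [Nonempty A] [NeZero H] {Noff Non : ℕ} (hoff : 1 ≤ Noff)
    (hon : 1 ≤ Non) {δ : ℝ} (hδ : 0 < δ) (hδ1 : δ < 1) {Xoff Xon : Set (S × A × Fin H)}
    (hr : ratioNorm M πoff Xoff = ⊤) : regretBound M πoff Noff Non δ Xoff Xon = ⊤ := by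
  have hH : (0 : ℝ) < H := by exact_mod_cast NeZero.pos H
  have hS : (0 : ℝ) < Fintype.card S := by exact_mod_cast Fintype.card_pos
  have hA : (0 : ℝ) < Fintype.card A := by exact_mod_cast Fintype.card_pos
  have h1 : (0 : ℝ) < Noff := by exact_mod_cast hoff
  have h2 : (0 : ℝ) < Non := by exact_mod_cast hon
  have hl : 0 < Real.log (((Noff + Non : ℕ) : ℝ) / δ) := by
    refine Real.log_pos ?_
    rw [lt_div_iff₀ hδ, one_mul]
    refine hδ1.trans_le ?_
    exact_mod_cast (by omega : 1 ≤ Noff + Non)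
  rw [regretBound, hr, ENNReal.mul_top (ENNReal.ofReal_pos.2 (by positivity)).ne',
    ENNReal.top_rpow_of_pos (by norm_num), top_add]

lemma regretBound_eq_ofReal {Noff Non : ℕ} (hon : 1 ≤ Non) {δ : ℝ} (hδ : 0 < δ) (hδ1 : δ < 1)
    {Xoff Xon : Set (S × A × Fin H)} (hr : ratioNorm M πoff Xoff ≠ ⊤) :
    regretBound M πoff Noff Non δ Xoff Xon = ENNReal.ofReal
      (Real.sqrt ((H : ℝ) ^ 5 * Fintype.card S * Fintype.card A *
        Real.log (((Noff + Non : ℕ) : ℝ) / δ) * ((Non : ℝ) ^ 2 / Noff) *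
        (ratioNorm M πoff Xoff).toReal) +
      Real.sqrt ((H : ℝ) ^ 5 * Fintype.card S * Fintype.card A * maxSlice Xon * Non *
        Real.log (((Noff + Non : ℕ) : ℝ) / δ) * Real.log ((Noff + Non : ℕ) : ℝ))) := by
  have hl : 0 ≤ Real.log (((Noff + Non : ℕ) : ℝ) / δ) := by
    refine Real.log_nonneg ?_
    rw [le_div_iff₀ hδ, one_mul]
    refine hδ1.le.trans ?_
    exact_mod_cast (by omega : 1 ≤ Noff + Non)
  rw [ENNReal.ofReal_add (Real.sqrt_nonneg _) (Real.sqrt_nonneg _), regretBound]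
  congr 1
  nth_rewrite 1 [← ENNReal.ofReal_toReal hr]
  rw [← ENNReal.ofReal_mul (by positivity), ENNReal.ofReal_rpow_of_nonneg
    (mul_nonneg (by positivity) ENNReal.toReal_nonneg) (by norm_num), Real.sqrt_eq_rpow]

/-- The offline policy compared with itself has ratio 1 at any cell that it visits. -/
lemma one_le_ratioNorm_univ [NeZero H] : 1 ≤ ratioNorm M πoff Set.univ := by
  obtain ⟨s, a, hsa⟩ : ∃ s a, 0 < occ M πoff 0 s a := by
    by_contra! hcon
    have h1 := occ_sum M πoff 0
    have h2 : ∑ s, ∑ a, occ M πoff 0 s a ≤ 0 :=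
      Finset.sum_nonpos fun s _ => Finset.sum_nonpos fun a _ => hcon s a
    linarith
  refine le_iSup_of_le πoff (le_iSup_of_le (s, a, 0) (le_of_eq ?_))
  rw [Set.indicator_of_mem (Set.mem_univ _)]
  exact (ENNReal.div_self (ENNReal.ofReal_pos.2 hsa).ne' ENNReal.ofReal_ne_top).symm

lemma one_le_maxSlice {X : Set (S × A × Fin H)} (hX : X.Nonempty) : 1 ≤ maxSlice X := by
  obtain ⟨⟨s, a, h⟩, hx⟩ := hX
  refine le_trans ?_ (card_sliceFinset_le X h)
  exact Finset.card_pos.2 ⟨(s, a), mem_sliceFinset.2 hx⟩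

lemma regret_le_mul [Nonempty A] [NeZero H] {Noff Non : ℕ} (L : Learner S A H Noff)
    (ω : (Fin Noff → Traj S A H) × (Fin Non → Traj S A H)) : regret M L ω ≤ Non * H := by
  refine (Finset.sum_le_sum fun t _ => (sub_le_self _ (value_nonneg M _)).trans
    (optValue_le M)).trans (le_of_eq ?_)
  rw [Finset.sum_const, nsmul_eq_mul, Finset.card_univ, Fintype.card_fin]

end Regret

/-! ### Optimism and the regret of DISC-GOLF on the accurate event. -/

section DiscGolf

variable {S A : Type*} [Fintype S] [Fintype A] [Nonempty A] {H : ℕ} [NeZero H] {M : MDP S A H}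
  {πoff : Policy S A H} {Noff Non : ℕ} {warm : Bool} {gr : QFun S A H → Fin H → S → A}
  {sel : (t : ℕ) → (Fin Noff → Traj S A H) → (Fin t → Traj S A H) → QFun S A H} {x : ℝ}
  {ω : (Fin Noff → Traj S A H) × (Fin Non → Traj S A H)}

/-- Clipping lowers the backup, so it can only raise the signed error. Only this one-sided bound is
needed, since optimism bounds regret by signed Bellman errors. -/
lemma bellmanErr_le_abs_clipErr (f : QFun S A H) (h : Fin H) (s : S) (a : A) :
    bellmanErr M f h s a ≤ |clipErr M h (f h) (nextQ f h) s a| :=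
  (sub_le_sub_left (min_le_left _ _) _).trans (le_abs_self _)

/-- Optimism: the regret of an episode is at most the sum of the clipped Bellman errors of the
selected function. -/
lemma optValue_sub_value_le (hgr : IsGreedy gr)
    (hsel : IsDiscGolf M ((H : ℝ) ^ 2 * (100 * x)) warm gr sel) (hx : 0 ≤ x)
    (hω : ω ∈ accurateEvent M πoff (golfLearner gr sel) x) (t : Fin Non)
    (ht : ¬((t : ℕ) = 0 ∧ warm = false)) :
    optValue M - value M (playedPolicy (golfLearner gr sel) ω t) ≤
      ∑ h, expect (occ M (playedPolicy (golfLearner gr sel) ω t) h) fun s a =>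
        |clipErr M h (sel t ω.1 (history ω.2 t) h) (nextQ (sel t ω.1 (history ω.2 t)) h) s a| := by
  have hmax := (hsel t ω.1 (history ω.2 t)).2 (optQ M)
    (by rw [candSet, if_neg ht]; exact optQ_mem_confSet hx hω t)
  have hopt := optValue_le_iSup_optQ M
  rw [iSup_eq_of_isGreedy hgr] at hopt
  have hdec := greedy_sub_value M hgr (sel t ω.1 (history ω.2 t))
  refine le_trans (sub_le_sub_right (hopt.trans hmax) _) (hdec.le.trans ?_)
  exact Finset.sum_le_sum fun h _ => expect_mono (occ_nonneg M _ h) fun s a =>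
    bellmanErr_le_abs_clipErr _ h s a

lemma sum_ite_val_eq_zero_le (hon : 1 ≤ Non) (warm : Bool) {c : ℝ} :
    ∑ t : Fin Non, (if (t : ℕ) = 0 ∧ warm = false then c else 0) =
      if warm = false then c else 0 := by
  have : ∀ t : Fin Non, (if (t : ℕ) = 0 ∧ warm = false then c else 0) =
      if t = ⟨0, hon⟩ then (if warm = false then c else 0) else 0 := fun t => by
    rw [ite_and]
    simp only [Fin.ext_iff]
  simp only [this, Finset.sum_ite_eq', Finset.mem_univ, if_true]

lemma regret_le_of_mem_accurateEvent (hoff : 1 ≤ Noff) (hon : 1 ≤ Non) (hgr : IsGreedy gr)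
    (hsel : IsDiscGolf M ((H : ℝ) ^ 2 * (100 * x)) warm gr sel) (hx : Real.log 2 ≤ x)
    (hω : ω ∈ accurateEvent M πoff (golfLearner gr sel) x) {Xoff Xon : Set (S × A × Fin H)}
    (hX : Xoff ∪ Xon = Set.univ) (hr : ratioSup M πoff Xoff ≠ ⊤) :
    regret M (golfLearner gr sel) ω ≤ (if warm = false then (H : ℝ) else 0) +
      H * (Non * Real.sqrt ((ratioSup M πoff Xoff).toReal * (761 * ((H : ℝ) ^ 2 * x) / Noff)) +
        Real.sqrt (24 * (maxSlice Xon * Real.log (1 + Non)) *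
          (Non * (761 * ((H : ℝ) ^ 2 * x))))) := by
  have hl2 := Real.log_two_gt_d9
  have hx0 : 0 ≤ x := by linarith
  set π := fun t => playedPolicy (golfLearner gr sel) ω t with hπ
  set f := fun t : Fin Non => sel t ω.1 (history ω.2 t) with hf
  -- In a cold start the first function need not lie in a confidence set. Its error is set to 0
  -- here, and that episode is charged separately with its trivial regret `H`.
  set u : Fin Non → Fin H → S → A → ℝ := fun t h s a =>
    if (t : ℕ) = 0 ∧ warm = false then 0 else clipErr M h (f t h) (nextQ (f t) h) s a with hu
  have hfconf : ∀ t : Fin Non, ¬((t : ℕ) = 0 ∧ warm = false) →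
      f t ∈ confSet M ((H : ℝ) ^ 2 * (100 * x)) ω.1 (history ω.2 t) := fun t ht => by
    have := (hsel t ω.1 (history ω.2 t)).1
    rwa [candSet, if_neg ht] at this
  have hu1 : ∀ t h s a, |u t h s a| ≤ H := fun t h s a => by
    by_cases ht : (t : ℕ) = 0 ∧ warm = false
    · simp [hu, ht]
    · simp only [hu, if_neg ht]
      exact abs_clipErr_le M ((hfconf t ht).1 h) (nextQ_mem (hfconf t ht).1 h) h s a
  have hH2 : (0 : ℝ) ≤ (H : ℝ) ^ 2 := sq_nonneg _
  have hW : (H : ℝ) ^ 2 ≤ 761 * ((H : ℝ) ^ 2 * x) := by nlinarith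
  have hE : ∀ t h, Noff * expect (occ M πoff h) (fun s a => u t h s a ^ 2) +
      ∑ i ∈ Finset.Iio t, expect (occ M (π i) h) (fun s a => u t h s a ^ 2) ≤
      761 * ((H : ℝ) ^ 2 * x) := fun t h => by
    by_cases ht : (t : ℕ) = 0 ∧ warm = false
    · simp only [hu, if_pos ht]
      simp [expect]
      positivity
    · simp only [hu, if_neg ht]
      exact dataErr_le_of_mem_confSet hω t (hfconf t ht) h
  have key := sum_expect_abs_le M πoff hX hr hoff π u hu1 hW hE
  refine le_trans ?_ (add_le_add (sum_ite_val_eq_zero_le hon warm).le key)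
  rw [← Finset.sum_add_distrib]
  refine Finset.sum_le_sum fun t _ => ?_
  by_cases ht : (t : ℕ) = 0 ∧ warm = false
  · rw [if_pos ht]
    have h1 : 0 ≤ ∑ h, expect (occ M (π t) h) (fun s a => |u t h s a|) :=
      Finset.sum_nonneg fun h _ => expect_nonneg (occ_nonneg M _ h) fun s a => abs_nonneg _
    linarith [optValue_le M, value_nonneg M (playedPolicy (golfLearner gr sel) ω t)]
  · rw [if_neg ht, zero_add]
    simp only [hu, if_neg ht]
    exact optValue_sub_value_le hgr hsel hx0 hω t ht

end DiscGolf

/-! ### Comparison with the stated bound -/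

lemma mul_sqrt_le_mul_sqrt {a b c q : ℝ} (ha : 0 ≤ a) (hc : 0 ≤ c) (h : a ^ 2 * b ≤ c ^ 2 * q) :
    a * Real.sqrt b ≤ c * Real.sqrt q := by
  have h1 : ∀ {y z : ℝ}, 0 ≤ y → y * Real.sqrt z = Real.sqrt (y ^ 2 * z) := fun {y z} hy => by
    rw [Real.sqrt_mul (sq_nonneg _), Real.sqrt_sq hy]
  rw [h1 ha, h1 hc]
  exact Real.sqrt_le_sqrt h

section Final

variable {S A : Type*} [Fintype S] [Fintype A] [Nonempty S] [Nonempty A] {H : ℕ} [NeZero H]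
  {M : MDP S A H} {πoff : Policy S A H} {Noff Non : ℕ} {δ : ℝ}

/-- With fewer episodes than steps, `H^5` dominates the square of the trivial bound `Non * H`. A
nonempty `Xon` makes the online term large enough; otherwise `Xoff` is everything, its ratio is at
least 1, and the offline term suffices because `Noff ≤ H`. -/
lemma regret_le_regretBound_of_lt (hoff : 1 ≤ Noff) (hon : 1 ≤ Non) (hδ : 0 < δ) (hδ1 : δ < 1)
    (hHN : Noff + Non < H) (L : Learner S A H Noff)
    (ω : (Fin Noff → Traj S A H) × (Fin Non → Traj S A H)) {Xoff Xon : Set (S × A × Fin H)}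
    (hX : Xoff ∪ Xon = Set.univ) :
    ENNReal.ofReal (regret M L ω) ≤
      ENNReal.ofReal 400 * regretBound M πoff Noff Non δ Xoff Xon := by
  by_cases hr : ratioNorm M πoff Xoff = ⊤
  · rw [regretBound_eq_top hoff hon hδ hδ1 hr, ENNReal.mul_top (by simp)]
    exact le_top
  rw [regretBound_eq_ofReal hon hδ hδ1 hr, ← ENNReal.ofReal_mul (by norm_num)]
  refine ENNReal.ofReal_le_ofReal ((regret_le_mul L ω).trans ?_)
  have hl2 := Real.log_two_gt_d9
  have hn : (1 : ℝ) ≤ Noff := by exact_mod_cast hoff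
  have hT : (1 : ℝ) ≤ Non := by exact_mod_cast hon
  have hnH : (Noff : ℝ) ≤ H := by exact_mod_cast (by omega : Noff ≤ H)
  have hTH : (Non : ℝ) ≤ H := by exact_mod_cast (by omega : Non ≤ H)
  have hS : (1 : ℝ) ≤ Fintype.card S := by exact_mod_cast Fintype.card_pos
  have hA : (1 : ℝ) ≤ Fintype.card A := by exact_mod_cast Fintype.card_pos
  have hN : (2 : ℝ) ≤ (Noff + Non : ℕ) := by exact_mod_cast (by omega : 2 ≤ Noff + Non)
  have hlN : (1 : ℝ) / 2 ≤ Real.log ((Noff + Non : ℕ) : ℝ) :=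
    (by linarith : (1 : ℝ) / 2 ≤ Real.log 2).trans (Real.log_le_log two_pos hN)
  have hl : (1 : ℝ) / 2 ≤ Real.log (((Noff + Non : ℕ) : ℝ) / δ) := by
    refine hlN.trans (Real.log_le_log (by linarith) ?_)
    rw [le_div_iff₀ hδ]
    nlinarith
  have hH : (1 : ℝ) ≤ H := hn.trans hnH
  set l := Real.log (((Noff + Non : ℕ) : ℝ) / δ)
  set lN := Real.log ((Noff + Non : ℕ) : ℝ)
  set P : ℝ := (H : ℝ) ^ 5 * Fintype.card S * Fintype.card A with hP
  have hP5 : (H : ℝ) ^ 5 ≤ P := by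
    rw [hP, mul_assoc]
    exact le_mul_of_one_le_right (by positivity) (one_le_mul_of_one_le_of_one_le hS hA)
  rcases Xon.eq_empty_or_nonempty with hXon | hXon
  · have hXoff : Xoff = Set.univ := by rwa [hXon, Set.union_empty] at hX
    subst hXoff
    have hr1 : 1 ≤ (ratioNorm M πoff Set.univ).toReal := by
      rw [← ENNReal.toReal_one]
      exact ENNReal.toReal_mono hr one_le_ratioNorm_univ
    have h1 : ((Non : ℝ) * H) * Real.sqrt 1 ≤ 2 * Real.sqrt (P * l * ((Non : ℝ) ^ 2 / Noff) *
        (ratioNorm M πoff Set.univ).toReal) := by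
      refine mul_sqrt_le_mul_sqrt (by positivity) (by norm_num) ?_
      calc ((Non : ℝ) * H) ^ 2 * 1 = (H : ℝ) ^ 2 * (Non : ℝ) ^ 2 := by ring
        _ ≤ (H : ℝ) ^ 4 * (Non : ℝ) ^ 2 :=
          mul_le_mul_of_nonneg_right (pow_le_pow_right₀ hH (by norm_num)) (by positivity)
        _ = (H : ℝ) ^ 5 * ((Non : ℝ) ^ 2 / H) := by field_simp
        _ ≤ P * ((Non : ℝ) ^ 2 / Noff) := by gcongr
        _ = 2 * P * (1 / 2) * ((Non : ℝ) ^ 2 / Noff) * 1 := by ring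
        _ ≤ 2 * P * l * ((Non : ℝ) ^ 2 / Noff) * (ratioNorm M πoff Set.univ).toReal := by gcongr
        _ ≤ _ := by
          have : 0 ≤ P * l * ((Non : ℝ) ^ 2 / Noff) * (ratioNorm M πoff Set.univ).toReal := by
            positivity
          linarith
    rw [Real.sqrt_one, mul_one] at h1
    have h2 := Real.sqrt_nonneg (P * maxSlice Xon * Non * l * lN)
    have h3 := Real.sqrt_nonneg (P * l * ((Non : ℝ) ^ 2 / Noff) *
        (ratioNorm M πoff Set.univ).toReal)
    linarith
  · have hm : (1 : ℝ) ≤ maxSlice Xon := by exact_mod_cast one_le_maxSlice hXon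
    have h1 : ((Non : ℝ) * H) * Real.sqrt 1 ≤ 2 * Real.sqrt (P * maxSlice Xon * Non * l * lN) := by
      refine mul_sqrt_le_mul_sqrt (by positivity) (by norm_num) ?_
      calc ((Non : ℝ) * H) ^ 2 * 1 = (H : ℝ) ^ 2 * Non * Non := by ring
        _ ≤ (H : ℝ) ^ 2 * H * Non := by gcongr
        _ = (H : ℝ) ^ 3 * Non := by ring
        _ ≤ (H : ℝ) ^ 5 * Non :=
          mul_le_mul_of_nonneg_right (pow_le_pow_right₀ hH (by norm_num)) (by positivity)
        _ ≤ P * Non := by gcongr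
        _ = 4 * (P * 1 * Non * (1 / 2) * (1 / 2)) := by ring
        _ ≤ 4 * (P * maxSlice Xon * Non * l * lN) := by gcongr
        _ = _ := by norm_num
    rw [Real.sqrt_one, mul_one] at h1
    have h2 := Real.sqrt_nonneg (P * maxSlice Xon * Non * l * lN)
    have h3 := Real.sqrt_nonneg (P * l * ((Non : ℝ) ^ 2 / Noff) * (ratioNorm M πoff Xoff).toReal)
    linarith

lemma regret_le_regretBound_of_le {warm : Bool} {gr : QFun S A H → Fin H → S → A}
    {sel : (t : ℕ) → (Fin Noff → Traj S A H) → (Fin t → Traj S A H) → QFun S A H}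
    {ω : (Fin Noff → Traj S A H) × (Fin Non → Traj S A H)}
    (hoff : 1 ≤ Noff) (hon : 1 ≤ Non) (hδ : 0 < δ) (hδ1 : δ < 1)
    (hHN : H ≤ Noff + Non) (hgr : IsGreedy gr)
    (hsel : IsDiscGolf M ((H : ℝ) ^ 2 * (100 * logCover S A H (Noff + Non) δ)) warm gr sel)
    (hω : ω ∈ accurateEvent M πoff (golfLearner gr sel) (logCover S A H (Noff + Non) δ))
    {Xoff Xon : Set (S × A × Fin H)}
    (hX : Xoff ∪ Xon = Set.univ) (hXon : warm = false → Xon.Nonempty) :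
    ENNReal.ofReal (regret M (golfLearner gr sel) ω) ≤
      ENNReal.ofReal 400 * regretBound M πoff Noff Non δ Xoff Xon := by
  by_cases hr : ratioNorm M πoff Xoff = ⊤
  · rw [regretBound_eq_top hoff hon hδ hδ1 hr, ENNReal.mul_top (by simp)]
    exact le_top
  have hH1 : 1 ≤ H := NeZero.pos H
  have hx := log_two_le_logCover S A hH1 (by omega : 2 ≤ Noff + Non) hδ hδ1
  have hx5 := logCover_le S A hH1 (by omega : 2 ≤ Noff + Non) hHN hδ hδ1
  have hreg := regret_le_of_mem_accurateEvent hoff hon hgr hsel hx hω hX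
    (by rwa [ratioSup_eq_ratioNorm])
  rw [ratioSup_eq_ratioNorm] at hreg
  rw [regretBound_eq_ofReal hon hδ hδ1 hr, ← ENNReal.ofReal_mul (by norm_num)]
  refine ENNReal.ofReal_le_ofReal (hreg.trans ?_)
  have hl2 := Real.log_two_gt_d9
  have hn : (1 : ℝ) ≤ Noff := by exact_mod_cast hoff
  have hT : (1 : ℝ) ≤ Non := by exact_mod_cast hon
  have hH : (1 : ℝ) ≤ H := by exact_mod_cast hH1
  have hS : (1 : ℝ) ≤ Fintype.card S := by exact_mod_cast Fintype.card_pos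
  have hA : (1 : ℝ) ≤ Fintype.card A := by exact_mod_cast Fintype.card_pos
  have hN : (2 : ℝ) ≤ (Noff + Non : ℕ) := by exact_mod_cast (by omega : 2 ≤ Noff + Non)
  have hlN : (1 : ℝ) / 2 ≤ Real.log ((Noff + Non : ℕ) : ℝ) :=
    (by linarith : (1 : ℝ) / 2 ≤ Real.log 2).trans (Real.log_le_log two_pos hN)
  have hl : (1 : ℝ) / 2 ≤ Real.log (((Noff + Non : ℕ) : ℝ) / δ) := by
    refine hlN.trans (Real.log_le_log (by linarith) ?_)
    rw [le_div_iff₀ hδ]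
    nlinarith
  have hlog0 : 0 ≤ Real.log (1 + (Non : ℝ)) := Real.log_nonneg (by linarith)
  have hlogT : Real.log (1 + (Non : ℝ)) ≤ Real.log ((Noff + Non : ℕ) : ℝ) := by
    refine Real.log_le_log (by linarith) ?_
    push_cast
    linarith
  have hr0 : 0 ≤ (ratioNorm M πoff Xoff).toReal := ENNReal.toReal_nonneg
  have hx0 : 0 ≤ logCover S A H (Noff + Non) δ := by linarith
  set x := logCover S A H (Noff + Non) δ
  set l := Real.log (((Noff + Non : ℕ) : ℝ) / δ)
  set lN := Real.log ((Noff + Non : ℕ) : ℝ)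
  set r := (ratioNorm M πoff Xoff).toReal
  set s := (Fintype.card S : ℝ)
  set a := (Fintype.card A : ℝ)
  set m : ℝ := (maxSlice Xon : ℝ) with hm
  have hm0 : 0 ≤ m := Nat.cast_nonneg _
  -- `761 * 5 = 3805 ≤ 62²`.
  have hoffT : ((H : ℝ) * Non) * Real.sqrt (r * (761 * ((H : ℝ) ^ 2 * x) / Noff)) ≤
      62 * Real.sqrt ((H : ℝ) ^ 5 * s * a * l * ((Non : ℝ) ^ 2 / Noff) * r) := by
    refine mul_sqrt_le_mul_sqrt (by positivity) (by norm_num) ?_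
    calc ((H : ℝ) * Non) ^ 2 * (r * (761 * ((H : ℝ) ^ 2 * x) / Noff))
        ≤ ((H : ℝ) * Non) ^ 2 * (r * (761 * ((H : ℝ) ^ 2 * (5 * (H * s * a * l))) / Noff)) := by
          gcongr
      _ = 3805 * ((H : ℝ) ^ 5 * s * a * l * ((Non : ℝ) ^ 2 / Noff) * r) := by ring
      _ ≤ _ := by
        refine mul_le_mul_of_nonneg_right (by norm_num) (by positivity)
  -- `24 * 761 * 5 = 91320 ≤ 303²`.
  have honT : (H : ℝ) * Real.sqrt (24 * (m * Real.log (1 + Non)) *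
      (Non * (761 * ((H : ℝ) ^ 2 * x)))) ≤
      303 * Real.sqrt ((H : ℝ) ^ 5 * s * a * m * Non * l * lN) := by
    refine mul_sqrt_le_mul_sqrt (by positivity) (by norm_num) ?_
    calc (H : ℝ) ^ 2 * (24 * (m * Real.log (1 + Non)) * (Non * (761 * ((H : ℝ) ^ 2 * x))))
        ≤ (H : ℝ) ^ 2 * (24 * (m * lN) *
          (Non * (761 * ((H : ℝ) ^ 2 * (5 * (H * s * a * l)))))) := by gcongr
      _ = 91320 * ((H : ℝ) ^ 5 * s * a * m * Non * l * lN) := by ring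
      _ ≤ _ := by
        refine mul_le_mul_of_nonneg_right (by norm_num) (by positivity)
  -- A nonempty `Xon` gives `m ≥ 1`, so the online term absorbs the cost of the first cold-start
  -- episode. The factor 2 makes up for the two logarithms, each at least `1/2`.
  have hcold : (if warm = false then (H : ℝ) else 0) ≤
      2 * Real.sqrt ((H : ℝ) ^ 5 * s * a * m * Non * l * lN) := by
    split_ifs with hw
    · have hm1 : 1 ≤ m := by
        rw [hm]
        exact_mod_cast one_le_maxSlice (hXon hw)
      have : (H : ℝ) * Real.sqrt 1 ≤
          2 * Real.sqrt ((H : ℝ) ^ 5 * s * a * m * Non * l * lN) := by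
        refine mul_sqrt_le_mul_sqrt (by positivity) (by norm_num) ?_
        calc (H : ℝ) ^ 2 * 1 = (H : ℝ) ^ 2 := mul_one _
          _ ≤ (H : ℝ) ^ 5 := pow_le_pow_right₀ hH (by norm_num)
          _ = 2 ^ 2 * ((H : ℝ) ^ 5 * 1 * 1 * 1 * 1 * (1 / 2) * (1 / 2)) := by ring
          _ ≤ _ := by gcongr
      rwa [Real.sqrt_one, mul_one] at this
    · positivity
  have h2 := Real.sqrt_nonneg ((H : ℝ) ^ 5 * s * a * m * Non * l * lN)
  have h3 := Real.sqrt_nonneg ((H : ℝ) ^ 5 * s * a * l * ((Non : ℝ) ^ 2 / Noff) * r)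
  rw [mul_add, ← mul_assoc (H : ℝ)]
  linarith

/-- The regret guarantee of DISC-GOLF. -/
lemma one_sub_le_probEvent_regret (hoff : 1 ≤ Noff) (hon : 1 ≤ Non) (hδ : 0 < δ) (hδ1 : δ < 1)
    {warm : Bool} {gr : QFun S A H → Fin H → S → A}
    {sel : (t : ℕ) → (Fin Noff → Traj S A H) → (Fin t → Traj S A H) → QFun S A H}
    (hgr : IsGreedy gr)
    (hsel : IsDiscGolf M ((H : ℝ) ^ 2 * (100 * logCover S A H (Noff + Non) δ)) warm gr sel) :
    1 - δ ≤ probEvent (Non := Non) M πoff (golfLearner gr sel)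
      {ω | ENNReal.ofReal (regret M (golfLearner gr sel) ω) ≤
        ENNReal.ofReal 400 *
          ⨅ (Xoff : Set (S × A × Fin H)) (Xon : Set (S × A × Fin H))
            (_ : Xoff ∪ Xon = Set.univ) (_ : warm = false → Xon.Nonempty),
            regretBound M πoff Noff Non δ Xoff Xon} := by
  refine (one_sub_le_probEvent_accurateEvent M πoff (golfLearner gr sel) (NeZero.pos H) hoff hon
    hδ hδ1).trans (probEvent_mono M πoff _ fun ω hω => ?_)
  have hC0 : ENNReal.ofReal 400 ≠ 0 := by simp
  -- Dividing by the constant exposes the infimum, so each pair `(Xoff, Xon)` can be treated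
  -- separately. The accurate event does not depend on the pair, so no further union bound is
  -- needed.
  refine (ENNReal.div_le_iff' hC0 ENNReal.ofReal_ne_top).1 ?_
  refine le_iInf fun Xoff => le_iInf fun Xon => le_iInf fun hX => le_iInf fun hXon => ?_
  refine (ENNReal.div_le_iff' hC0 ENNReal.ofReal_ne_top).2 ?_
  rcases le_or_gt H (Noff + Non) with hHN | hHN
  · exact regret_le_regretBound_of_le hoff hon hδ hδ1 hHN hgr hsel hω hX hXon
  · exact regret_le_regretBound_of_lt hoff hon hδ hδ1 hHN _ ω hX

end Final

end HybridRL

end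

theorem proposition1 :
    ∃ c₁ C : ℝ, 0 < c₁ ∧ 0 < C ∧
      ∀ (S : Type*) (A : Type*) [Fintype S] [Fintype A] [Nonempty S] [Nonempty A]
        (H : ℕ) [NeZero H] (M : MDP S A H) (πoff : Policy S A H) (Noff Non : ℕ),
        1 ≤ Noff → 1 ≤ Non →
        -- the offline complexity measure
        (∀ Xoff : Set (S × A × Fin H),
          cOff M πoff Xoff ≤ ratioSup M πoff Xoff ∧
            ratioSup M πoff Xoff = ratioNorm M πoff Xoff) ∧
        -- the online complexity measure
        (2 ≤ Non → ∀ Xon : Set (S × A × Fin H),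
          cOn M Xon Non ≤ ENNReal.ofReal (C * (maxSlice Xon * Real.log Non))) ∧
        -- the regret of DISC-GOLF
        (∀ (δ : ℝ), 0 < δ → δ < 1 →
          ∀ (warm : Bool) (gr : QFun S A H → Fin H → S → A)
            (sel : (t : ℕ) → (Fin Noff → Traj S A H) → (Fin t → Traj S A H) → QFun S A H),
            IsGreedy gr →
            IsDiscGolf M ((H : ℝ) ^ 2 * (c₁ * logCover S A H (Noff + Non) δ)) warm gr sel →
            1 - δ ≤ probEvent (Non := Non) M πoff (golfLearner gr sel)
              {ω | ENNReal.ofReal (regret M (golfLearner gr sel) ω) ≤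
                ENNReal.ofReal C *
                  ⨅ (Xoff : Set (S × A × Fin H)) (Xon : Set (S × A × Fin H))
                    (_ : Xoff ∪ Xon = Set.univ) (_ : warm = false → Xon.Nonempty),
                    regretBound M πoff Noff Non δ Xoff Xon}) := by
  -- 400 exceeds the regret constants 62 and `303 + 2`, as well as the 48 of the online coefficient.
  refine ⟨100, 400, by norm_num, by norm_num, ?_⟩
  intro S A _ _ _ _ H _ M πoff Noff Non hoff hon
  refine ⟨fun Xoff => ⟨cOff_le_ratioSup M πoff Xoff, ratioSup_eq_ratioNorm M πoff Xoff⟩,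
    fun hT Xon => cOn_le M Xon hT (by norm_num), ?_⟩
  intro δ hδ hδ1 warm gr sel hgr hsel
  exact one_sub_le_probEvent_regret hoff hon hδ hδ1 hgr hsel
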